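/- Let $0<q<1$ and $r\ge 1$, and put $[k]=\frac{1-q^k}{1-q}$ for integers $k\ge 1$. The Bradley–Zhao (BZ) model of the multiple $q$-zeta function of depth $r$ is $$\zeta_q^{\mathrm{BZ}}(s_1,\dots,s_r)=\sum_{k_1>\dots>k_r\ge 1}\frac{q^{k_1(s_1-1)+\dots+k_r(s_r-1)}}{[k_1]^{s_1}\cdots[k_r]^{s_r}},\qquad \operatorname{Re}(s_1+\dots+s_d)>d\quad(1\le d\le r).$$ The series converges absolutely on this domain, and $\zeta_q^{\mathrm{BZ}}$ extends to a meromorphic function on $\mathbb{C}^r$. For any such meromorphic extension, the set of its poles, i.e. of the points of $\mathbb{C}^r$ at which it is not holomorphic, is exactly the set of all $(s_1,\dots,s_r)\in\mathbb{C}^r$ such that $$s_1\in 1+\tfrac{2\pi i}{\log q}\mathbb{Z},\quad\text{or}\quad s_1\in\mathbb{Z}_{\le 0}+\tfrac{2\pi i}{\log q}\mathbb{Z}_{\ne 0},\quad\text{or}\quad s_1+\dots+s_j\in\mathbb{Z}_{\le j}+\tfrac{2\pi i}{\log q}\mathbb{Z}\ \text{ for some } 2\le j\le r.$$ All poles are simple: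 near each pole the extension is a quotient of two holomorphic functions whose denominator is squarefree as a germ at that point, i.e. the extension has pole order one along every irreducible component of its polar set. -/

import Mathlib

open Filter Topology

/-! ### Meromorphic functions of several complex variables

A meromorphic function on `ℂ^r` is represented by a total function `F : (Fin r → ℂ) → ℂ` which is
locally a quotient `g / h` of analytic functions with `h` not identically zero near the point; the
values of `F` on the zero set of `h` are irrelevant. -/

/-- Near `p`, the function `F` is represented by the quotient `g / h` of germs of analytic
functions, where `h` is not the zero germ. -/
def IsQuotientAt {r : ℕ} (F g h : (Fin r → ℂ) → ℂ) (p : Fin r → ℂ) : Prop :=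
  AnalyticAt ℂ g p ∧ AnalyticAt ℂ h p ∧ (∃ᶠ z in 𝓝 p, h z ≠ 0) ∧
    ∀ᶠ z in 𝓝 p, h z ≠ 0 → F z = g z / h z

/-- `F` is (a representative of) a meromorphic function on all of `ℂ^r`. -/
def IsMeromorphic {r : ℕ} (F : (Fin r → ℂ) → ℂ) : Prop :=
  ∀ p, ∃ g h : (Fin r → ℂ) → ℂ, IsQuotientAt F g h p

/-- The meromorphic function `F` is holomorphic at `p`: off a thin analytic set it agrees near `p`
with a function that is analytic at `p`. -/
def IsRegularAt {r : ℕ} (F : (Fin r → ℂ) → ℂ) (p : Fin r → ℂ) : Prop :=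
  ∃ f h : (Fin r → ℂ) → ℂ, AnalyticAt ℂ f p ∧ AnalyticAt ℂ h p ∧ (∃ᶠ z in 𝓝 p, h z ≠ 0) ∧
    ∀ᶠ z in 𝓝 p, h z ≠ 0 → F z = f z

/-- The poles of a meromorphic function `F`: the points at which `F` is not holomorphic. -/
def poles {r : ℕ} (F : (Fin r → ℂ) → ℂ) : Set (Fin r → ℂ) :=
  {p | ¬ IsRegularAt F p}

/-- The germ of `h` at `p` is squarefree in the ring of germs of analytic functions: if `a ^ 2`
divides it, then `a` is a unit. -/
def IsSquarefreeGermAt {r : ℕ} (h : (Fin r → ℂ) → ℂ) (p : Fin r → ℂ) : Prop :=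
  ∀ a b : (Fin r → ℂ) → ℂ, AnalyticAt ℂ a p → AnalyticAt ℂ b p →
    (∀ᶠ z in 𝓝 p, h z = a z ^ 2 * b z) → a p ≠ 0

/-- `p` is a simple pole of `F`: a pole near which `F` is a quotient with squarefree denominator,
that is, `F` has pole order one along every component through `p` of its polar divisor. -/
def IsSimplePole {r : ℕ} (F : (Fin r → ℂ) → ℂ) (p : Fin r → ℂ) : Prop :=
  p ∈ poles F ∧ ∃ g h : (Fin r → ℂ) → ℂ, IsQuotientAt F g h p ∧ IsSquarefreeGermAt h p

/-! ### The Bradley–Zhao model of the multiple `q`-zeta function -/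

noncomputable section

/-- The `q`-analogue `[k] = (1 - q ^ k) / (1 - q)`. -/
def qInt (q : ℝ) (k : ℕ) : ℝ := (1 - q ^ k) / (1 - q)

/-- `s_1 + ⋯ + s_j` (the coordinate `s_i` is `s (i - 1)` in the indexing by `Fin r`). -/
def partialSum {r : ℕ} (s : Fin r → ℂ) (j : ℕ) : ℂ :=
  ∑ i : Fin r with i.val < j, s i

/-- The domain of convergence: `Re (s_1 + ⋯ + s_d) > d` for `1 ≤ d ≤ r`. -/
def bzDomain (r : ℕ) : Set (Fin r → ℂ) :=
  {s | ∀ d : ℕ, 1 ≤ d → d ≤ r → (d : ℝ) < (partialSum s d).re}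

/-- Index tuples `k_1 > ⋯ > k_r ≥ 1`. -/
def BZIndex (r : ℕ) : Type := {k : Fin r → ℕ // StrictAnti k ∧ ∀ i, 1 ≤ k i}

/-- The summand `q ^ (k_1 (s_1 - 1) + ⋯ + k_r (s_r - 1)) / ([k_1] ^ s_1 ⋯ [k_r] ^ s_r)`. -/
def bzTerm {r : ℕ} (q : ℝ) (s : Fin r → ℂ) (k : BZIndex r) : ℂ :=
  (q : ℂ) ^ (∑ i, (k.1 i : ℂ) * (s i - 1)) / ∏ i, ((qInt q (k.1 i) : ℝ) : ℂ) ^ (s i)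

/-- The series defining the BZ model of the multiple `q`-zeta function of depth `r`. -/
def bzZeta {r : ℕ} (q : ℝ) (s : Fin r → ℂ) : ℂ := ∑' k : BZIndex r, bzTerm q s k

/-- `F` is a meromorphic continuation of the BZ model to `ℂ^r`. -/
def IsBZContinuation {r : ℕ} (q : ℝ) (F : (Fin r → ℂ) → ℂ) : Prop :=
  IsMeromorphic F ∧ ∀ s ∈ bzDomain r, F s = bzZeta q s

/-- The number `2 π i / log q`. -/
def qPeriod (q : ℝ) : ℂ := 2 * Real.pi * Complex.I / (Real.log q : ℂ)

/-- The set of points `s` such that `s_1 ∈ 1 + (2πi / log q) ℤ`, or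
`s_1 ∈ ℤ_{≤ 0} + (2πi / log q) ℤ_{≠ 0}`, or
`s_1 + ⋯ + s_j ∈ ℤ_{≤ j} + (2πi / log q) ℤ` for some `2 ≤ j ≤ r`. -/
def bzPoleSet (q : ℝ) (r : ℕ) : Set (Fin r → ℂ) :=
  {s | (∃ b : ℤ, partialSum s 1 = 1 + qPeriod q * b) ∨
    (∃ a b : ℤ, a ≤ 0 ∧ b ≠ 0 ∧ partialSum s 1 = a + qPeriod q * b) ∨
    (∃ j : ℕ, 2 ≤ j ∧ j ≤ r ∧ ∃ a b : ℤ, a ≤ j ∧ partialSum s j = a + qPeriod q * b)}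

end

/-! Expand `(1 - q ^ k₁) ^ (-s₁)` in the binomial series and sum the geometric series over the gap
`k₁ - k₂`. With an extra weight `q ^ (c k₁)` and `u = c + s₁ - 1`, the depth `k + 1` series becomes
`∑ₙ binomCoeff s₁ n * q ^ (u + n) / (1 - q ^ (u + n))` times the depth `k` series of weight `u + n`
(`zTerm_step`). Multiplication by the entire function `qE q u = ∏ₘ (1 - q ^ (u + m))` removes the
poles of all terms at once. Iteration yields an entire numerator `bzNum` over `bzDen`, the product
of the `qE q (s₁ + ⋯ + sⱼ - j)`, and every continuation agrees with this quotient off thin sets.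

Where `q ^ (u + N) = 1`, all terms but one vanish, so the numerator can be evaluated: at suitable
points of each zero hyperplane of `bzDen` it is a product of nonzero factors and `binomCoeff s₁ N`.
This coefficient vanishes on `s₁ = 1 - N` with `N ≥ 1`; the corresponding hyperplanes are exactly
those that cancel (`bzNum_eq_zero`, `isRegularAt`). On any other hyperplane the numerator is not
identically zero, so a holomorphic extension is impossible at each of its points
(`not_isRegularAt`).

Simplicity holds because `qE q` has simple zeros and distinct partial sums give distinct
hyperplanes. Since the values of a continuation are free on a thin set, the denominator must also
vanish there: a squarefree germ off whose zeros the quotient formula holds is chosen by minimal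
order on a line, and `bzDen` divides it. -/

/-! ### The infinite product over `1 - q ^ (u + m)` and its zeros. -/

/-- The product of the factors `1 - q ^ (u + m)` over the `m` in `A`. -/
noncomputable def qProd (q : ℝ) (A : Set ℕ) (u : ℂ) : ℂ :=
  ∏' m : ℕ, (1 + A.indicator (fun m : ℕ => -(q : ℂ) ^ (u + m)) m)

section
variable {q : ℝ}

lemma norm_qpow (hq0 : 0 < q) (u : ℂ) (m : ℕ) : ‖(q : ℂ) ^ (u + m)‖ = q ^ u.re * q ^ m := by
  rw [Complex.norm_cpow_eq_rpow_re_of_pos hq0]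
  simp [Real.rpow_add hq0]

lemma norm_qpow_indicator_le (hq0 : 0 < q) (A : Set ℕ) (u : ℂ) (m : ℕ) :
    ‖A.indicator (fun m : ℕ => -(q : ℂ) ^ (u + m)) m‖ ≤ q ^ u.re * q ^ m := by
  rw [← norm_qpow hq0, ← norm_neg ((q : ℂ) ^ (u + m))]
  exact norm_indicator_le_norm_self _ _

lemma summable_qpow_indicator (hq0 : 0 < q) (hq1 : q < 1) (A : Set ℕ) (u : ℂ) :
    Summable fun m => ‖A.indicator (fun m : ℕ => -(q : ℂ) ^ (u + m)) m‖ :=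
  Summable.of_nonneg_of_le (fun _ => norm_nonneg _) (norm_qpow_indicator_le hq0 A u)
    ((summable_geometric_of_lt_one hq0.le hq1).mul_left _)

lemma qpow_differentiable (hq0 : 0 < q) (z : ℂ) : Differentiable ℂ fun u : ℂ => (q : ℂ) ^ (u + z) := by
  have : (q : ℂ) ≠ 0 := by exact_mod_cast hq0.ne'
  intro u
  exact (differentiableAt_id.add_const z).const_cpow (Or.inl this)

lemma qProd_differentiable (hq0 : 0 < q) (hq1 : q < 1) (A : Set ℕ) :
    Differentiable ℂ (qProd q A) := by
  intro u
  set R : ℝ := u.re - 1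
  set U : Set ℂ := {z | R < z.re}
  have hU : IsOpen U := isOpen_lt continuous_const Complex.continuous_re
  have hd : ∀ m, Differentiable ℂ
      fun z : ℂ => A.indicator (fun m : ℕ => -(q : ℂ) ^ (z + m)) m := by
    intro m
    by_cases hm : m ∈ A
    · simp only [Set.indicator_of_mem hm]
      exact (qpow_differentiable hq0 m).neg
    · simp only [Set.indicator_of_notMem hm]
      exact differentiable_const 0
  have := Summable.hasProdLocallyUniformlyOn_nat_one_add
    (f := fun (m : ℕ) (z : ℂ) => A.indicator (fun m : ℕ => -(q : ℂ) ^ (z + m)) m) hU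
    (u := fun m => q ^ R * q ^ m) ((summable_geometric_of_lt_one hq0.le hq1).mul_left _)
    (Eventually.of_forall fun m z hz => (norm_qpow_indicator_le hq0 A z m).trans ?_)
    (fun m => (hd m).continuous.continuousOn)
  · refine (this.differentiableOn (.of_forall fun s => ?_) hU).differentiableAt
      (hU.mem_nhds (by simp [U, R]))
    simpa [Finset.prod_fn] using
      DifferentiableOn.finsetProd (fun m _ => ((hd m).const_add 1).differentiableOn)
  · gcongr ?_ * _
    exact Real.rpow_le_rpow_of_exponent_ge hq0 hq1.le (le_of_lt hz)

lemma norm_qProd_le (hq0 : 0 < q) (hq1 : q < 1) (A : Set ℕ) (u : ℂ) :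
    ‖qProd q A u‖ ≤ Real.exp (q ^ u.re * (1 - q)⁻¹) := by
  have hm := multipliable_one_add_of_summable (summable_qpow_indicator hq0 hq1 A u)
  refine le_of_tendsto hm.hasProd.norm (.of_forall fun s => ?_)
  refine (Finset.prod_le_prod (fun _ _ => norm_nonneg _) (fun m _ =>
    (norm_add_le _ _).trans (add_le_add norm_one.le (norm_qpow_indicator_le hq0 A u m)))).trans ?_
  refine (Real.prod_one_add_le_exp_sum s fun m => by positivity).trans (Real.exp_le_exp.2 ?_)
  rw [← tsum_geometric_of_lt_one hq0.le hq1, ← tsum_mul_left]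
  exact Summable.sum_le_tsum s (fun m _ => by positivity)
    ((summable_geometric_of_lt_one hq0.le hq1).mul_left _)

lemma qProd_ne_zero (hq0 : 0 < q) (hq1 : q < 1) {A : Set ℕ} {u : ℂ}
    (h : ∀ m ∈ A, (q : ℂ) ^ (u + m) ≠ 1) : qProd q A u ≠ 0 := by
  refine tprod_one_add_ne_zero_of_summable (fun m => ?_) (summable_qpow_indicator hq0 hq1 A u)
  by_cases hm : m ∈ A
  · rw [Set.indicator_of_mem hm, ← sub_eq_add_neg]
    exact sub_ne_zero.2 (h m hm).symm
  · simp [Set.indicator_of_notMem hm]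

lemma qProd_eq_mul (hq0 : 0 < q) (hq1 : q < 1) (A : Set ℕ) {n : ℕ} (hn : n ∈ A) (u : ℂ) :
    qProd q A u = (1 - (q : ℂ) ^ (u + n)) * qProd q (A \ {n}) u := by
  have key : Function.update (fun m => 1 + A.indicator (fun m : ℕ => -(q : ℂ) ^ (u + m)) m) n 1 =
      fun m => 1 + (A \ {n}).indicator (fun m : ℕ => -(q : ℂ) ^ (u + m)) m := by
    ext m
    by_cases hm : m = n
    · subst hm; simp
    · by_cases hA : m ∈ A <;> simp [hm, hA]
  have hm := multipliable_one_add_of_summable (summable_qpow_indicator hq0 hq1 (A \ {n}) u)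
  unfold qProd
  rw [Multipliable.tprod_eq_mul_tprod_ite' n (by rw [key]; exact hm),
    Set.indicator_of_mem hn, ← sub_eq_add_neg]
  congr 1
  refine tprod_congr fun m => ?_
  by_cases hm : m = n
  · subst hm; simp
  · by_cases hA : m ∈ A <;> simp [hm, hA]

/-- The entire function `∏ₘ (1 - q ^ (u + m))`. -/
noncomputable def qE (q : ℝ) (u : ℂ) : ℂ := qProd q Set.univ u

/-- The entire function `qE q u * q ^ (u + n) / (1 - q ^ (u + n))`. -/
noncomputable def qPhi (q : ℝ) (n : ℕ) (u : ℂ) : ℂ := (q : ℂ) ^ (u + n) * qProd q {n}ᶜ u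

lemma qE_eq_mul (hq0 : 0 < q) (hq1 : q < 1) (n : ℕ) (u : ℂ) :
    qE q u = (1 - (q : ℂ) ^ (u + n)) * qProd q {n}ᶜ u := by
  rw [qE, qProd_eq_mul hq0 hq1 _ (Set.mem_univ n), Set.compl_eq_univ_sdiff]

lemma qE_differentiable (hq0 : 0 < q) (hq1 : q < 1) : Differentiable ℂ (qE q) :=
  qProd_differentiable hq0 hq1 _

lemma qPhi_differentiable (hq0 : 0 < q) (hq1 : q < 1) (n : ℕ) : Differentiable ℂ (qPhi q n) :=
  (qpow_differentiable hq0 n).mul (qProd_differentiable hq0 hq1 _)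

lemma qE_eq_zero_iff (hq0 : 0 < q) (hq1 : q < 1) {u : ℂ} :
    qE q u = 0 ↔ ∃ n : ℕ, (q : ℂ) ^ (u + n) = 1 := by
  constructor
  · intro h
    by_contra! hc
    exact qProd_ne_zero hq0 hq1 (fun m _ => hc m) h
  · rintro ⟨n, hn⟩
    rw [qE_eq_mul hq0 hq1 n, hn, sub_self, zero_mul]

/-- The decay `q ^ n`, uniform on a half plane, leaves room for the weights `ρ ^ (-n)` with `q < ρ`
in `phiSeq`. -/
lemma norm_qPhi_le (hq0 : 0 < q) (hq1 : q < 1) {R : ℝ} {u : ℂ} (hu : R ≤ u.re) (n : ℕ) :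
    ‖qPhi q n u‖ ≤ q ^ R * Real.exp (q ^ R * (1 - q)⁻¹) * q ^ n := by
  have h1 : q ^ u.re ≤ q ^ R := Real.rpow_le_rpow_of_exponent_ge hq0 hq1.le hu
  have h2 : 0 ≤ (1 - q)⁻¹ := inv_nonneg.2 (by linarith)
  rw [qPhi, norm_mul, norm_qpow hq0, mul_right_comm]
  gcongr
  refine (norm_qProd_le hq0 hq1 _ u).trans ?_
  gcongr

lemma qE_mul_eq_qPhi (hq0 : 0 < q) (hq1 : q < 1) {n : ℕ} {u : ℂ} (h : (q : ℂ) ^ (u + n) ≠ 1) :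
    qE q u * ((q : ℂ) ^ (u + n) / (1 - (q : ℂ) ^ (u + n))) = qPhi q n u := by
  have : 1 - (q : ℂ) ^ (u + n) ≠ 0 := sub_ne_zero.2 h.symm
  rw [qE_eq_mul hq0 hq1 n, qPhi]
  field_simp

lemma qpow_eq_one_iff (hq0 : 0 < q) (hq1 : q < 1) {u : ℂ} :
    (q : ℂ) ^ u = 1 ↔ ∃ b : ℤ, u = qPeriod q * b := by
  have hl : (Real.log q : ℂ) ≠ 0 := by exact_mod_cast (Real.log_neg hq0 hq1).ne
  rw [Complex.cpow_def_of_ne_zero (by exact_mod_cast hq0.ne'), ← Complex.ofReal_log hq0.le,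
    Complex.exp_eq_one_iff]
  refine exists_congr fun b => ?_
  rw [qPeriod]
  constructor
  · intro h
    field_simp
    rw [mul_comm, h]; ring
  · rintro rfl
    field_simp

lemma qPeriod_im_ne_zero (hq0 : 0 < q) (hq1 : q < 1) : (qPeriod q).im ≠ 0 := by
  have hl := (Real.log_neg hq0 hq1).ne
  have : qPeriod q = ((2 * Real.pi / Real.log q : ℝ) : ℂ) * Complex.I := by
    simp [qPeriod]; ring
  rw [this]
  simp [Real.pi_ne_zero, hl]

/-- Taking norms removes the phase. At most one factor of `qE q` vanishes at a point, which gives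
simple zeros and the collapse of series to one term. -/
lemma qpow_add_eq_one_unique (hq0 : 0 < q) (hq1 : q < 1) {u : ℂ} {m n : ℕ}
    (hm : (q : ℂ) ^ (u + m) = 1) (hn : (q : ℂ) ^ (u + n) = 1) : m = n := by
  have h := norm_qpow hq0 u m
  rw [hm, ← hn, norm_qpow hq0 u n] at h
  have h2 := mul_left_cancel₀ (Real.rpow_pos_of_pos hq0 _).ne' h
  exact (pow_right_injective₀ hq0 hq1.ne h2).symm

/-- If `q ^ (u + N) = 1`, then `u` is a zero of all `qPhi q n` except `qPhi q N`. -/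
lemma qPhi_eq_zero (hq0 : 0 < q) (hq1 : q < 1) {u : ℂ} {N n : ℕ}
    (hN : (q : ℂ) ^ (u + N) = 1) (hn : n ≠ N) : qPhi q n u = 0 := by
  rw [qPhi, qProd_eq_mul hq0 hq1 _ (n := N) (by simpa using hn.symm), hN]
  simp

lemma qProd_compl_ne_zero (hq0 : 0 < q) (hq1 : q < 1) {u : ℂ} {N : ℕ}
    (hN : (q : ℂ) ^ (u + N) = 1) : qProd q {N}ᶜ u ≠ 0 :=
  qProd_ne_zero hq0 hq1 fun _ hm h => hm (qpow_add_eq_one_unique hq0 hq1 h hN)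

lemma qPhi_ne_zero (hq0 : 0 < q) (hq1 : q < 1) {u : ℂ} {N : ℕ}
    (hN : (q : ℂ) ^ (u + N) = 1) : qPhi q N u ≠ 0 := by
  rw [qPhi, hN, one_mul]
  exact qProd_compl_ne_zero hq0 hq1 hN

/-- The zeros of `qE q` are simple. -/
lemma qE_eq_sub_mul (hq0 : 0 < q) (hq1 : q < 1) {c : ℂ} (hc : qE q c = 0) :
    ∃ k : ℂ → ℂ, AnalyticAt ℂ k c ∧ k c ≠ 0 ∧ ∀ u, qE q u = (u - c) * k u := by
  obtain ⟨N, hN⟩ := (qE_eq_zero_iff hq0 hq1).1 hc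
  have hd := qE_differentiable hq0 hq1
  refine ⟨dslope (qE q) c, ?_, ?_, fun u => ?_⟩
  · have : DifferentiableOn ℂ (dslope (qE q) c) Set.univ :=
      (Complex.differentiableOn_dslope Filter.univ_mem).2 hd.differentiableOn
    exact this.analyticAt Filter.univ_mem
  · rw [dslope_same]
    have h1 : HasDerivAt (fun u : ℂ => (1 - (q : ℂ) ^ (u + N)) * qProd q {N}ᶜ u)
        (-(Real.log q : ℂ) * qProd q {N}ᶜ c) c := by
      have h2 : HasDerivAt (fun u : ℂ => (q : ℂ) ^ (u + N)) ((q : ℂ) ^ (c + N) * Complex.log q * 1) c :=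
        ((hasDerivAt_id c).add_const (N : ℂ)).const_cpow (Or.inl (by exact_mod_cast hq0.ne'))
      have h3 := (h2.const_sub 1).mul (qProd_differentiable hq0 hq1 {N}ᶜ c).hasDerivAt
      convert! h3 using 1
      rw [hN, Complex.ofReal_log hq0.le]; ring
    rw [show qE q = _ from funext (qE_eq_mul hq0 hq1 N), h1.deriv]
    refine mul_ne_zero (neg_ne_zero.2 ?_) (qProd_compl_ne_zero hq0 hq1 hN)
    exact_mod_cast (Real.log_neg hq0 hq1).ne
  · have := sub_smul_dslope (qE q) c u
    rw [hc, sub_zero, smul_eq_mul] at this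
    exact this.symm

end

/-! ### Binomial coefficients and analytic families of bounded sequences. -/

open scoped BoundedContinuousFunction

/-- The coefficient of `x ^ n` in `(1 - x) ^ (-s)`. -/
noncomputable def binomCoeff (s : ℂ) (n : ℕ) : ℂ := ∏ i ∈ Finset.range n, (s + i) / (i + 1)

lemma binomCoeff_zero (s : ℂ) : binomCoeff s 0 = 1 := by simp [binomCoeff]

lemma binomCoeff_eq_choose (s : ℂ) (n : ℕ) : binomCoeff s n = Ring.choose (s + n - 1) n := by
  rw [Ring.choose_eq_smul, Polynomial.descPochhammer_smeval_eq_ascPochhammer,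
    show s + n - 1 - n + 1 = s by ring, Polynomial.ascPochhammer_smeval_cast,
    Polynomial.ascPochhammer_smeval_eq_eval, binomCoeff]
  induction n with
  | zero => simp
  | succ n ih =>
    rw [Finset.prod_range_succ, ih, ascPochhammer_succ_eval, Nat.factorial_succ]
    have : (n : ℂ) + 1 ≠ 0 := by exact_mod_cast n.succ_ne_zero
    have h2 : (n.factorial : ℂ) ≠ 0 := by exact_mod_cast n.factorial_ne_zero
    simp only [smul_eq_mul]
    push_cast
    field_simp

lemma hasSum_binomCoeff (s : ℂ) {x : ℂ} (hx : ‖x‖ < 1) :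
    HasSum (fun n => binomCoeff s n * x ^ n) (1 / (1 - x) ^ s) := by
  have h := (Complex.one_div_one_sub_cpow_hasFPowerSeriesOnBall_zero s).hasSum (y := x)
    (by simpa [enorm_eq_nnnorm] using! hx)
  simpa [binomCoeff_eq_choose, mul_comm] using h

lemma binomCoeff_differentiable (n : ℕ) : Differentiable ℂ fun s => binomCoeff s n := by
  unfold binomCoeff
  fun_prop

lemma binomCoeff_eq_zero_iff {s : ℂ} {n : ℕ} : binomCoeff s n = 0 ↔ ∃ i < n, s = -(i : ℂ) := by
  rw [binomCoeff, Finset.prod_eq_zero_iff]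
  refine exists_congr fun i => ?_
  have : (i : ℂ) + 1 ≠ 0 := by exact_mod_cast i.succ_ne_zero
  rw [Finset.mem_range, div_eq_zero_iff, or_iff_left this, add_eq_zero_iff_eq_neg]

/-- Each factor satisfies `‖s + i‖ ≤ R + i`, so on a bounded set of `s` the series is dominated by a
single binomial series. -/
lemma norm_binomCoeff_le {s : ℂ} {R : ℝ} (h : ‖s‖ ≤ R) (n : ℕ) :
    ‖binomCoeff s n‖ ≤ ‖binomCoeff R n‖ := by
  have hR := (norm_nonneg s).trans h
  rw [binomCoeff, binomCoeff, norm_prod, norm_prod]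
  refine Finset.prod_le_prod (fun _ _ => norm_nonneg _) fun i _ => ?_
  rw [norm_div, norm_div]
  gcongr
  calc ‖s + i‖ ≤ ‖s‖ + i := by simpa using norm_add_le s i
    _ ≤ R + i := by gcongr
    _ = ‖(R : ℂ) + i‖ := by
      rw [← Complex.ofReal_natCast, ← Complex.ofReal_add, Complex.norm_of_nonneg (by positivity)]

lemma summable_norm_binomCoeff (s : ℂ) {ρ : ℝ} (h0 : 0 ≤ ρ) (h1 : ρ < 1) :
    Summable fun n => ‖binomCoeff s n‖ * ρ ^ n := by
  have := (hasSum_binomCoeff s (x := ρ) (by simpa [abs_of_nonneg h0] using h1)).summable.norm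
  simpa [abs_of_nonneg h0] using this

/-- The left shift on bounded sequences. -/
noncomputable def seqShift : (ℕ →ᵇ ℂ) →L[ℂ] (ℕ →ᵇ ℂ) :=
  LinearMap.mkContinuous
    { toFun := fun a => a.compContinuous ⟨fun m => m + 1, continuous_of_discreteTopology⟩
      map_add' := fun _ _ => rfl
      map_smul' := fun _ _ => rfl } 1
    (fun a => by
      rw [one_mul]
      exact (BoundedContinuousFunction.norm_le (norm_nonneg _)).2 fun m => a.norm_coe_le_norm (m + 1))

lemma seqShift_pow_apply (n : ℕ) (a : ℕ →ᵇ ℂ) (m : ℕ) : (seqShift ^ n) a m = a (m + n) := by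
  induction n generalizing m with
  | zero => simp
  | succ n ih =>
    rw [pow_succ']
    change (seqShift ^ n) a (m + 1) = _
    rw [ih]
    congr 1
    ring

lemma norm_seqShift_pow_le (n : ℕ) : ‖seqShift ^ n‖ ≤ 1 := by
  refine ContinuousLinearMap.opNorm_le_bound _ zero_le_one fun a => ?_
  rw [one_mul]
  refine (BoundedContinuousFunction.norm_le (norm_nonneg _)).2 fun m => ?_
  rw [seqShift_pow_apply]
  exact a.norm_coe_le_norm _

/-- The bounded sequence with the single nonzero entry `1` at `n`. -/
noncomputable def seqSingle (n : ℕ) : ℕ →ᵇ ℂ :=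
  BoundedContinuousFunction.ofNormedAddCommGroup (fun m => if m = n then 1 else 0)
    continuous_of_discreteTopology 1 (fun m => by split_ifs <;> simp)

lemma norm_seqSingle_le (n : ℕ) : ‖seqSingle n‖ ≤ 1 :=
  BoundedContinuousFunction.norm_ofNormedAddCommGroup_le _ zero_le_one _

/-- A function given by a series that converges normally on bounded sets is entire. -/
lemma differentiable_tsum_of_bounded {V : Type*} [NormedAddCommGroup V] [NormedSpace ℂ V]
    [CompleteSpace V] {f : ℕ → ℂ → V} (hf : ∀ n, Differentiable ℂ (f n))
    (hb : ∀ R : ℝ, ∃ b : ℕ → ℝ, Summable b ∧ ∀ n z, ‖z‖ ≤ R → ‖f n z‖ ≤ b n) :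
    (Differentiable ℂ fun z => ∑' n, f n z) ∧ ∀ z, Summable fun n => ‖f n z‖ := by
  refine ⟨fun z => ?_, fun z => ?_⟩
  · obtain ⟨b, hb, hbd⟩ := hb (‖z‖ + 1)
    refine (Complex.differentiableOn_tsum_of_summable_norm hb (fun n => (hf n).differentiableOn)
      (Metric.isOpen_ball (x := (0 : ℂ)) (ε := ‖z‖ + 1)) fun n w hw => ?_).differentiableAt
        (Metric.isOpen_ball.mem_nhds (by simp))
    exact hbd n w (le_of_lt (by simpa using hw))
  · obtain ⟨b, hb, hbd⟩ := hb ‖z‖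
    exact Summable.of_nonneg_of_le (fun _ => norm_nonneg _) (fun n => hbd n z le_rfl) hb

section
variable {q : ℝ}

/-- The operator `∑ₙ binomCoeff s n * ρ ^ n * shiftⁿ`. -/
noncomputable def binomOp (ρ : ℝ) (s : ℂ) : (ℕ →ᵇ ℂ) →L[ℂ] (ℕ →ᵇ ℂ) :=
  ∑' n, (binomCoeff s n * (ρ : ℂ) ^ n) • seqShift ^ n

lemma binomOp_aux {ρ : ℝ} (h0 : 0 ≤ ρ) (h1 : ρ < 1) :
    Differentiable ℂ (binomOp ρ) ∧
      ∀ s, Summable fun n => ‖(binomCoeff s n * (ρ : ℂ) ^ n) • seqShift ^ n‖ := by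
  refine differentiable_tsum_of_bounded (V := (ℕ →ᵇ ℂ) →L[ℂ] (ℕ →ᵇ ℂ))
    (f := fun n s => (binomCoeff s n * (ρ : ℂ) ^ n) • seqShift ^ n) (fun n => ?_) fun R => ?_
  · exact ((binomCoeff_differentiable n).mul_const _).smul_const _
  · refine ⟨_, summable_norm_binomCoeff R h0 h1, fun n z hz => ?_⟩
    rw [norm_smul, norm_mul, norm_pow, Complex.norm_of_nonneg h0]
    refine (mul_le_of_le_one_right (by positivity) (norm_seqShift_pow_le n)).trans ?_
    gcongr
    exact norm_binomCoeff_le hz n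

lemma binomOp_apply {ρ : ℝ} (h0 : 0 ≤ ρ) (h1 : ρ < 1) (s : ℂ) (a : ℕ →ᵇ ℂ) (m : ℕ) :
    binomOp ρ s a m = ∑' n, binomCoeff s n * (ρ : ℂ) ^ n * a (m + n) := by
  have h := ((binomOp_aux h0 h1).2 s).of_norm.hasSum
  have h2 := ((BoundedContinuousFunction.evalCLM ℂ m).comp
    (ContinuousLinearMap.apply ℂ (ℕ →ᵇ ℂ) a)).hasSum h
  refine (h2.tsum_eq.symm.trans (tsum_congr fun n => ?_))
  change (binomCoeff s n * (ρ : ℂ) ^ n) * (seqShift ^ n) a m = _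
  rw [seqShift_pow_apply]

/-- The sequence with entries `ρ ^ (-n) * qPhi q n u`. -/
noncomputable def phiSeq (q ρ : ℝ) (u : ℂ) : ℕ →ᵇ ℂ :=
  ∑' n, (((ρ : ℂ) ^ n)⁻¹ * qPhi q n u) • seqSingle n

lemma phiSeq_aux {ρ : ℝ} (hq0 : 0 < q) (hq1 : q < 1) (hρ : q < ρ) :
    Differentiable ℂ (phiSeq q ρ) ∧
      ∀ u, Summable fun n => ‖(((ρ : ℂ) ^ n)⁻¹ * qPhi q n u) • seqSingle n‖ := by
  have hρ0 : 0 < ρ := hq0.trans hρ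
  refine differentiable_tsum_of_bounded (fun n => ?_) fun R => ?_
  · exact ((qPhi_differentiable hq0 hq1 n).const_mul _).smul_const _
  -- On `‖z‖ ≤ R` the real part is at least `-R`, so `norm_qPhi_le` applies with `-R`; the ratio `q
  -- / ρ < 1` gives convergence.
  · refine ⟨fun n => q ^ (-R) * Real.exp (q ^ (-R) * (1 - q)⁻¹) * (q / ρ) ^ n,
      (summable_geometric_of_lt_one (by positivity) ((div_lt_one hρ0).2 hρ)).mul_left _,
      fun n z hz => ?_⟩
    have hz' : -R ≤ z.re := by
      have := (abs_le.1 (Complex.abs_re_le_norm z)).1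
      linarith
    rw [norm_smul]
    refine (mul_le_of_le_one_right (by positivity) (norm_seqSingle_le n)).trans ?_
    rw [norm_mul, norm_inv, norm_pow, Complex.norm_of_nonneg hρ0.le, inv_mul_le_iff₀ (by positivity)]
    refine (norm_qPhi_le hq0 hq1 hz' n).trans (le_of_eq ?_)
    simp only [div_pow]
    field_simp

lemma phiSeq_apply {ρ : ℝ} (hq0 : 0 < q) (hq1 : q < 1) (hρ : q < ρ) (u : ℂ) (m : ℕ) :
    phiSeq q ρ u m = ((ρ : ℂ) ^ m)⁻¹ * qPhi q m u := by
  have h := ((phiSeq_aux hq0 hq1 hρ).2 u).of_norm.hasSum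
  have h2 := (BoundedContinuousFunction.evalCLM ℂ m).hasSum h
  refine (h2.tsum_eq.symm.trans ?_)
  rw [tsum_eq_single m]
  · simp [seqSingle]
  · intro n hn
    simp [seqSingle, hn.symm]

/-- The bounded sequence `ρ ^ m`, for `0 ≤ ρ ≤ 1`. -/
noncomputable def geomSeq (ρ : ℝ) (h0 : 0 ≤ ρ) (h1 : ρ ≤ 1) : ℕ →ᵇ ℂ :=
  BoundedContinuousFunction.ofNormedAddCommGroup (fun m => (ρ : ℂ) ^ m)
    continuous_of_discreteTopology 1 (fun m => by
      rw [norm_pow, Complex.norm_of_nonneg h0]; exact pow_le_one₀ h0 h1)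

lemma lt_sqrt_self (hq0 : 0 < q) (hq1 : q < 1) : q < √q :=
  Real.lt_sqrt_of_sq_lt (by nlinarith)

lemma sqrt_lt_one (hq1 : q < 1) : √q < 1 := by
  rw [← Real.sqrt_one]; exact (Real.sqrt_lt_sqrt_iff_of_pos one_pos).2 hq1

end

/-! ### The recursively defined entire numerators. -/

/-- The sequence, in `m`, of the entire functions `bzEntire (k + 1) s c m`
which is `∑ₙ binomCoeff s₀ n * qPhi (m + n) u * bzEntire k (tail s) u (m + n)`, where `u = c + s₀ - 1`. -/
noncomputable def bzEntire (q : ℝ) (hq0 : 0 < q) (hq1 : q < 1) :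
    (k : ℕ) → (Fin k → ℂ) → ℂ → (ℕ →ᵇ ℂ)
  | 0, _, _ => 1
  | k + 1, s, c => geomSeq (√q) q.sqrt_nonneg (sqrt_lt_one hq1).le *
      binomOp (√q) (s 0) (phiSeq q (√q) (c + s 0 - 1) *
        bzEntire q hq0 hq1 k (Fin.tail s) (c + s 0 - 1))

section
variable {q : ℝ} (hq0 : 0 < q) (hq1 : q < 1)

/-- The weights cancel: `ρ ^ m * ρ ^ n * ρ ^ (-(m + n)) = 1`. The choice `ρ = √q` satisfies `q < ρ`,
needed by `phiSeq`, and `ρ < 1`, needed by `binomOp`. -/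
lemma bzEntire_succ_apply (k : ℕ) (s : Fin (k + 1) → ℂ) (c : ℂ) (m : ℕ) :
    bzEntire q hq0 hq1 (k + 1) s c m = ∑' n, binomCoeff (s 0) n * qPhi q (m + n) (c + s 0 - 1) *
      bzEntire q hq0 hq1 k (Fin.tail s) (c + s 0 - 1) (m + n) := by
  have hρ : (√q : ℂ) ≠ 0 := by exact_mod_cast (Real.sqrt_pos.2 hq0).ne'
  rw [bzEntire, BoundedContinuousFunction.mul_apply, binomOp_apply q.sqrt_nonneg (sqrt_lt_one hq1),
    ← tsum_mul_left]
  refine tsum_congr fun n => ?_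
  rw [BoundedContinuousFunction.mul_apply, phiSeq_apply hq0 hq1 (lt_sqrt_self hq0 hq1)]
  change (√q : ℂ) ^ m * _ = _
  rw [pow_add]
  field_simp

/-- Joint analyticity comes from composing analytic maps into Banach spaces. The arguments are
general functions `σ`, `γ` so that the induction survives passing to the tail and to the new weight.
-/
lemma bzEntire_analyticAt {E : Type*} [NormedAddCommGroup E] [NormedSpace ℂ E] {z : E} (k : ℕ)
    {σ : E → Fin k → ℂ} {γ : E → ℂ} (hσ : ∀ i, AnalyticAt ℂ (fun w => σ w i) z)
    (hγ : AnalyticAt ℂ γ z) : AnalyticAt ℂ (fun w => bzEntire q hq0 hq1 k (σ w) (γ w)) z := by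
  induction k generalizing γ with
  | zero => simp only [bzEntire]; exact analyticAt_const
  | succ k ih =>
    have hu : AnalyticAt ℂ (fun w => γ w + σ w 0 - 1) z := (hγ.add (hσ 0)).sub analyticAt_const
    have h1 := ih (σ := fun w => Fin.tail (σ w)) (fun i => hσ i.succ) hu
    have hop : AnalyticAt ℂ (binomOp √q) (σ z 0) :=
      Differentiable.analyticAt (binomOp_aux q.sqrt_nonneg (sqrt_lt_one hq1)).1 _
    have h2 := hop.comp (f := fun w => σ w 0) (hσ 0)
    have h3 := ((phiSeq_aux hq0 hq1 (lt_sqrt_self hq0 hq1)).1.analyticAt (γ z + σ z 0 - 1)).comp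
      (f := fun w => γ w + σ w 0 - 1) hu
    simp only [bzEntire]
    exact analyticAt_const.mul
      (((ContinuousLinearMap.id ℂ ((ℕ →ᵇ ℂ) →L[ℂ] (ℕ →ᵇ ℂ))).analyticAt_bilinear (_, _)).comp₂ h2
        (h3.mul h1))

end

/-! ### The multiple series and its recursion in the depth. -/

/-- The largest entry of an index tuple, and `0` for the empty tuple. -/
def BZIndex.top : {k : ℕ} → BZIndex k → ℕ
  | 0, _ => 0
  | _ + 1, K => K.1 0

lemma BZIndex.le_top : {k : ℕ} → (K : BZIndex k) → (i : Fin k) → K.1 i ≤ K.top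
  | _ + 1, K, i => K.2.1.antitone (Fin.zero_le i)

/-- Adding a new largest entry, at distance `a + 1` from the old one. -/
def BZIndex.consEquiv (k : ℕ) : ℕ × BZIndex k ≃ BZIndex (k + 1) where
  -- For `k = 0` the convention `top = 0` makes the new entry `a + 1`, which runs over all positive
  -- integers.
  toFun p := ⟨Fin.cons (p.1 + 1 + p.2.top) p.2.1, by
    intro i j hij
    induction j using Fin.cases with
    | zero => exact absurd hij (Fin.not_lt_zero i)
    | succ j =>
      induction i using Fin.cases with
      | zero =>
        have := p.2.le_top j
        simp only [Fin.cons_zero, Fin.cons_succ]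
        omega
      | succ i =>
        simp only [Fin.cons_succ]
        exact p.2.2.1 (Fin.succ_lt_succ_iff.1 hij), by
    intro i
    induction i using Fin.cases with
    | zero => simp only [Fin.cons_zero]; omega
    | succ i => simp only [Fin.cons_succ]; exact p.2.2.2 i⟩
  invFun K :=
    let K' : BZIndex k := ⟨Fin.tail K.1, fun _ _ h => K.2.1 (Fin.succ_lt_succ_iff.2 h),
      fun i => K.2.2 i.succ⟩
    (K.1 0 - 1 - K'.top, K')
  left_inv p := Prod.ext (by
    change p.1 + 1 + p.2.top - 1 - p.2.top = p.1
    omega) rfl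
  right_inv K := by
    apply Subtype.ext
    refine Eq.trans ?_ (Fin.cons_self_tail K.1)
    have h : ∀ K' : BZIndex k, K'.1 = Fin.tail K.1 → K'.top + 1 ≤ K.1 0 := by
      intro K' hK'
      match k, K, K', hK' with
      | 0, K, _, _ => exact K.2.2 0
      | k + 1, K, K', hK' =>
        have h1 : K.1 (Fin.succ 0) < K.1 0 := K.2.1 (Fin.succ_pos 0)
        have h2 : K'.top = K.1 (Fin.succ 0) := congrFun hK' 0
        omega
    have h3 := h ⟨Fin.tail K.1, fun _ _ h => K.2.1 (Fin.succ_lt_succ_iff.2 h),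
      fun i => K.2.2 i.succ⟩ rfl
    refine congrArg (fun x => (Fin.cons x (Fin.tail K.1) : Fin (k + 1) → ℕ)) ?_
    dsimp only
    omega

/-- The general term of the multiple series
`∑ q ^ (c k₁) ∏ q ^ (kᵢ (sᵢ - 1)) (1 - q ^ kᵢ) ^ (-sᵢ)`. -/
noncomputable def zTerm (q : ℝ) {k : ℕ} (s : Fin k → ℂ) (c : ℂ) (K : BZIndex k) : ℂ :=
  (q : ℂ) ^ (c * K.top) *
    ∏ i, ((q : ℂ) ^ ((K.1 i : ℂ) * (s i - 1)) * (1 / (1 - (q : ℂ) ^ K.1 i) ^ s i))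

/-- The region of absolute convergence of the series of `zTerm`. -/
def ZConv : {k : ℕ} → (Fin k → ℂ) → ℂ → Prop
  | 0, _, _ => True
  | _ + 1, s, c => 0 < (c + s 0 - 1).re ∧ ZConv (Fin.tail s) (c + s 0 - 1)

/-- The denominator `∏ⱼ qE q (c + s₁ + ⋯ + sⱼ - j)`. -/
noncomputable def zDenom (q : ℝ) : {k : ℕ} → (Fin k → ℂ) → ℂ → ℂ
  | 0, _, _ => 1
  | _ + 1, s, c => qE q (c + s 0 - 1) * zDenom q (Fin.tail s) (c + s 0 - 1)

section
variable {q : ℝ}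

lemma zTerm_add_natCast (hq0 : 0 < q) {k : ℕ} (s : Fin k → ℂ) (c : ℂ) (n : ℕ) (K : BZIndex k) :
    zTerm q s (c + n) K = (q : ℂ) ^ (n * K.top) * zTerm q s c K := by
  have hq : (q : ℂ) ≠ 0 := by exact_mod_cast hq0.ne'
  rw [zTerm, zTerm, ← mul_assoc, add_mul, Complex.cpow_add _ _ hq, mul_comm (_ ^ (c * _)),
    ← Nat.cast_mul, Complex.cpow_natCast]

lemma zTerm_cons (hq0 : 0 < q) {k : ℕ} (s : Fin (k + 1) → ℂ) (c : ℂ) (a : ℕ) (K : BZIndex k) :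
    zTerm q s c (BZIndex.consEquiv k (a, K)) =
      1 / (1 - (q : ℂ) ^ (a + 1 + K.top)) ^ s 0 *
        (((q : ℂ) ^ (c + s 0 - 1)) ^ (a + 1) * zTerm q (Fin.tail s) (c + s 0 - 1) K) := by
  have hq : (q : ℂ) ≠ 0 := by exact_mod_cast hq0.ne'
  have h1 : (BZIndex.consEquiv k (a, K)).top = a + 1 + K.top := rfl
  have h2 : (BZIndex.consEquiv k (a, K)).1 = Fin.cons (a + 1 + K.top) K.1 := rfl
  rw [zTerm, zTerm, h1, h2, Fin.prod_univ_succ]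
  simp only [Fin.cons_zero, Fin.cons_succ, Fin.tail]
  have h3 : (q : ℂ) ^ (c * ((a + 1 + K.top : ℕ) : ℂ)) *
      (q : ℂ) ^ (((a + 1 + K.top : ℕ) : ℂ) * (s 0 - 1)) =
      ((q : ℂ) ^ (c + s 0 - 1)) ^ (a + 1) * (q : ℂ) ^ ((c + s 0 - 1) * K.top) := by
    rw [← Complex.cpow_mul_nat, ← Complex.cpow_add _ _ hq, ← Complex.cpow_add _ _ hq]
    congr 1
    push_cast
    ring
  rw [← mul_assoc, ← mul_assoc, h3]
  ring

lemma ZConv.add_natCast : {k : ℕ} → {s : Fin k → ℂ} → {c : ℂ} → ZConv s c → (n : ℕ) →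
    ZConv s (c + n)
  | 0, _, _, _, _ => trivial
  | k + 1, s, c, h, n => by
    have e : c + n + s 0 - 1 = c + s 0 - 1 + n := by ring
    refine ⟨?_, ?_⟩
    · rw [e, Complex.add_re, Complex.natCast_re]
      have := h.1
      positivity
    · rw [e]
      exact h.2.add_natCast n

lemma norm_qpow_lt_one (hq0 : 0 < q) (hq1 : q < 1) {u : ℂ} (hu : 0 < u.re) :
    ‖(q : ℂ) ^ u‖ < 1 := by
  rw [Complex.norm_cpow_eq_rpow_re_of_pos hq0]
  exact Real.rpow_lt_one hq0.le hq1 hu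

/-- With `k₁ = a + 1 + k₂`, the binomial term `q ^ (n k₁)` splits into a power absorbed by the
geometric series in `a` and `q ^ (n k₂)`, which shifts the weight of the remaining series by `n`. -/
lemma zTerm_step (hq0 : 0 < q) (hq1 : q < 1) {k : ℕ} {s : Fin (k + 1) → ℂ} {c : ℂ}
    (hc : ZConv s c) (hs : Summable (zTerm q (Fin.tail s) (c + s 0 - 1))) :
    Summable (zTerm q s c) ∧ ∑' K, zTerm q s c K =
      ∑' n : ℕ, binomCoeff (s 0) n * ((q : ℂ) ^ (c + s 0 - 1 + n) /
        (1 - (q : ℂ) ^ (c + s 0 - 1 + n))) * ∑' K, zTerm q (Fin.tail s) (c + s 0 - 1 + n) K := by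
  have hq : (q : ℂ) ≠ 0 := by exact_mod_cast hq0.ne'
  have hu : 0 < (c + s 0 - 1).re := hc.1
  set u := c + s 0 - 1 with hu_def
  set f : ℕ × (ℕ × BZIndex k) → ℂ := fun p => binomCoeff (s 0) p.1 *
    (q : ℂ) ^ (p.1 * (p.2.1 + 1 + p.2.2.top)) *
      (((q : ℂ) ^ u) ^ (p.2.1 + 1) * zTerm q (Fin.tail s) u p.2.2) with hf_def
  have hgeo : ∀ w : ℂ, ‖w‖ < 1 → HasSum (fun a : ℕ => w ^ (a + 1)) (w / (1 - w)) := by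
    intro w hw
    simpa [pow_succ', div_eq_mul_inv] using (hasSum_geometric_of_norm_lt_one hw).mul_left w
  have hgeo' : ∀ w : ℂ, ‖w‖ < 1 → Summable (fun a : ℕ => ‖w ^ (a + 1)‖) :=
    fun w hw => (hgeo w hw).summable.norm
  have hsum : Summable f := by
    refine Summable.of_norm_bounded
      ((summable_norm_binomCoeff (s 0) hq0.le hq1).mul_of_nonneg
        ((hgeo' _ (norm_qpow_lt_one hq0 hq1 hu)).mul_of_nonneg hs.norm
          (fun _ => norm_nonneg _) (fun _ => norm_nonneg _))
        (fun n => by positivity) (fun _ => by positivity)) fun p => ?_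
    obtain ⟨n, a, K⟩ := p
    simp only [hf_def, norm_mul, norm_pow, Complex.norm_of_nonneg hq0.le]
    refine mul_le_mul_of_nonneg_right (mul_le_mul_of_nonneg_left ?_ (norm_nonneg _)) (by positivity)
    -- The exponent is at least `n` because `a + 1 + K.top ≥ 1`; this decouples the three
    -- summations.
    exact pow_le_pow_of_le_one hq0.le hq1.le (by nlinarith)
  have hinner : ∀ p : ℕ × BZIndex k, ∑' n, f (n, p) = zTerm q s c (BZIndex.consEquiv k p) := by
    rintro ⟨a, K⟩
    rw [zTerm_cons hq0, ← hu_def]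
    simp only [hf_def]
    rw [tsum_mul_right]
    congr 1
    have hx : ‖(q : ℂ) ^ (a + 1 + K.top)‖ < 1 := by
      rw [norm_pow, Complex.norm_of_nonneg hq0.le]
      exact pow_lt_one₀ hq0.le hq1 (by omega)
    rw [← (hasSum_binomCoeff (s 0) hx).tsum_eq]
    refine tsum_congr fun n => ?_
    rw [← pow_mul, mul_comm n]
  have hZ : Summable (zTerm q s c) := by
    rw [← (BZIndex.consEquiv k).summable_iff]
    refine (hsum.prod_symm.prod).congr fun p => ?_
    exact hinner p
  refine ⟨hZ, ?_⟩
  rw [← (BZIndex.consEquiv k).tsum_eq]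
  simp_rw [← hinner]
  rw [Summable.tsum_comm (f := fun n p => f (n, p)) hsum]
  refine tsum_congr fun n => ?_
  have hun : (q : ℂ) ^ (u + n) = (q : ℂ) ^ u * (q : ℂ) ^ n := by
    rw [Complex.cpow_add _ _ hq, Complex.cpow_natCast]
  have hn : ‖(q : ℂ) ^ (u + n)‖ < 1 := by
    apply norm_qpow_lt_one hq0 hq1
    rw [Complex.add_re, Complex.natCast_re]
    positivity
  have hsn : Summable fun K => zTerm q (Fin.tail s) (u + n) K := by
    refine Summable.of_norm_bounded hs.norm fun K => ?_
    rw [zTerm_add_natCast hq0, norm_mul, norm_pow, Complex.norm_of_nonneg hq0.le]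
    exact mul_le_of_le_one_left (norm_nonneg _) (pow_le_one₀ hq0.le hq1.le)
  rw [mul_assoc, ← (hgeo _ hn).tsum_eq,
    tsum_mul_tsum_of_summable_norm (hgeo' _ hn) hsn.norm, ← tsum_mul_left]
  refine tsum_congr fun p => ?_
  simp only [hf_def]
  rw [zTerm_add_natCast hq0, hun, mul_pow, ← pow_mul, mul_add, pow_add]
  ring

lemma summable_zTerm (hq0 : 0 < q) (hq1 : q < 1) : {k : ℕ} → {s : Fin k → ℂ} → {c : ℂ} →
    ZConv s c → Summable (zTerm q s c)
  | 0, _, _, _ => by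
    have : Finite (BZIndex 0) := by unfold BZIndex; infer_instance
    exact Summable.of_finite
  | k + 1, _, _, h => (zTerm_step hq0 hq1 h (summable_zTerm hq0 hq1 h.2)).1

/-- One denominator, taken at the unshifted `c`, serves every shift `m`: the term with index `n` has
the denominator `1 - q ^ (u + m + n)`, which is again a factor of `qE q u`. -/
lemma bzEntire_eq_tsum_mul (hq0 : 0 < q) (hq1 : q < 1) : {k : ℕ} → {s : Fin k → ℂ} → {c : ℂ} →
    ZConv s c → (m : ℕ) →
    bzEntire q hq0 hq1 k s c m = (∑' K, zTerm q s (c + m) K) * zDenom q s c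
  | 0, s, c, _, m => by
    have : Unique (BZIndex 0) := by
      refine ⟨⟨⟨Fin.elim0, fun i => i.elim0, fun i => i.elim0⟩⟩, fun a => ?_⟩
      exact Subtype.ext (Subsingleton.elim _ _)
    rw [tsum_eq_single default (fun b hb => absurd (Subsingleton.elim b default) hb)]
    simp [bzEntire, zTerm, zDenom, BZIndex.top]
  | k + 1, s, c, h, m => by
    have e : c + m + s 0 - 1 = c + s 0 - 1 + m := by ring
    have hm : ZConv s (c + m) := h.add_natCast m
    rw [(zTerm_step hq0 hq1 hm (summable_zTerm hq0 hq1 hm.2)).2, bzEntire_succ_apply, e,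
      ← tsum_mul_right]
    refine tsum_congr fun n => ?_
    have en : c + s 0 - 1 + m + n = c + s 0 - 1 + ((m + n : ℕ) : ℂ) := by push_cast; ring
    have hn : (q : ℂ) ^ (c + s 0 - 1 + ((m + n : ℕ) : ℂ)) ≠ 1 := by
      intro h1
      have h2 : ‖(q : ℂ) ^ (c + s 0 - 1 + ((m + n : ℕ) : ℂ))‖ < 1 := by
        apply norm_qpow_lt_one hq0 hq1
        rw [Complex.add_re, Complex.natCast_re]
        have := h.1
        positivity
      rw [h1, norm_one] at h2
      exact lt_irrefl _ h2
    rw [bzEntire_eq_tsum_mul hq0 hq1 h.2, en, ← qE_mul_eq_qPhi hq0 hq1 hn, zDenom]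
    ring

lemma partialSum_succ {k : ℕ} (s : Fin (k + 1) → ℂ) (j : ℕ) :
    partialSum s (j + 1) = s 0 + partialSum (Fin.tail s) j := by
  simp [partialSum, Finset.sum_filter, Fin.sum_univ_succ, Fin.tail]

lemma partialSum_zero {k : ℕ} (s : Fin k → ℂ) : partialSum s 0 = 0 := by
  simp [partialSum]

lemma partialSum_one {k : ℕ} (s : Fin (k + 1) → ℂ) : partialSum s 1 = s 0 := by
  rw [partialSum_succ, partialSum_zero, add_zero]

lemma zConv_of_forall : {k : ℕ} → {s : Fin k → ℂ} → {c : ℂ} →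
    (∀ d : ℕ, 1 ≤ d → d ≤ k → (d : ℝ) < (c + partialSum s d).re) → ZConv s c
  | 0, _, _, _ => trivial
  | k + 1, s, c, h => by
    refine ⟨?_, zConv_of_forall fun d hd1 hd2 => ?_⟩
    · have := h 1 le_rfl (by omega)
      rw [partialSum_one] at this
      simp only [Complex.sub_re, Complex.one_re]
      push_cast at this
      linarith
    · have := h (d + 1) (by omega) (by omega)
      rw [partialSum_succ] at this
      simp only [Complex.sub_re, Complex.one_re, Complex.add_re] at this ⊢
      push_cast at this
      linarith

lemma zDenom_eq_prod : {k : ℕ} → (s : Fin k → ℂ) → (c : ℂ) →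
    zDenom q s c = ∏ j : Fin k, qE q (c + partialSum s (j + 1) - (j + 1 : ℕ))
  | 0, _, _ => by simp [zDenom]
  | k + 1, s, c => by
    rw [Fin.prod_univ_succ, zDenom, zDenom_eq_prod]
    congr 1
    · simp [partialSum_one]
    · refine Finset.prod_congr rfl fun j _ => ?_
      congr 1
      rw [Fin.val_succ, partialSum_succ s]
      push_cast
      ring

lemma qpow_sum (hq0 : 0 < q) {ι : Type*} (t : Finset ι) (f : ι → ℂ) :
    (q : ℂ) ^ (∑ i ∈ t, f i) = ∏ i ∈ t, (q : ℂ) ^ f i := by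
  have hq : (q : ℂ) ≠ 0 := by exact_mod_cast hq0.ne'
  simp only [Complex.cpow_def_of_ne_zero hq, Finset.mul_sum, Complex.exp_sum]

/-- The powers of `1 - q` in the `[kᵢ]` do not depend on `K` and form an entire factor without
zeros. -/
lemma bzTerm_eq (hq0 : 0 < q) (hq1 : q < 1) {r : ℕ} (s : Fin r → ℂ) (K : BZIndex r) :
    bzTerm q s K = ((1 - q : ℝ) : ℂ) ^ (∑ i, s i) * zTerm q s 0 K := by
  have h1q : 0 < 1 - q := by linarith
  have hfac : ∀ i, ((qInt q (K.1 i) : ℝ) : ℂ) ^ (s i) =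
      (1 - (q : ℂ) ^ K.1 i) ^ s i / ((1 - q : ℝ) : ℂ) ^ s i := by
    intro i
    have h0 : 0 ≤ 1 - q ^ K.1 i := sub_nonneg.2 (pow_le_one₀ hq0.le hq1.le)
    have h2 : (1 - (q : ℂ) ^ K.1 i) = ((1 - q ^ K.1 i : ℝ) : ℂ) := by push_cast; rfl
    have h3 : qInt q (K.1 i) * (1 - q) = 1 - q ^ K.1 i := by
      rw [qInt, div_mul_cancel₀ _ h1q.ne']
    have h4 : ((1 - q : ℝ) : ℂ) ^ s i ≠ 0 := by
      rw [Complex.cpow_def_of_ne_zero (by exact_mod_cast h1q.ne')]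
      exact Complex.exp_ne_zero _
    have h5 : 0 ≤ qInt q (K.1 i) := div_nonneg h0 h1q.le
    rw [eq_div_iff h4, h2, ← h3, Complex.ofReal_mul, Complex.mul_cpow_ofReal_nonneg h5 h1q.le]
  rw [bzTerm, zTerm, qpow_sum hq0, qpow_sum h1q, Finset.prod_congr rfl fun i _ => hfac i,
    Finset.prod_div_distrib, Finset.prod_mul_distrib]
  simp only [zero_mul, Complex.cpow_zero, one_mul, Finset.prod_inv_distrib, div_eq_mul_inv,
    mul_inv, inv_inv]
  ring

end

/-! ### Division of an analytic germ by a linear form. -/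

open scoped ENNReal NNReal

section
variable {E : Type*} [NormedAddCommGroup E] [NormedSpace ℂ E]

/-- The telescoping quotient of a multilinear form by the linear form `ℓ`, where `π = 1 - ℓ ⊗ e`. -/
noncomputable def multilinearQuot {n : ℕ} (f : ContinuousMultilinearMap ℂ (fun _ : Fin (n + 1) => E) ℂ)
    (e : E) (π : E →L[ℂ] E) : ContinuousMultilinearMap ℂ (fun _ : Fin n => E) ℂ :=
  ∑ i : Fin (n + 1), (f.curryMid i e).compContinuousLinearMap
    fun j => if i.succAbove j < i then ContinuousLinearMap.id ℂ E else π

lemma multilinearQuot_spec {n : ℕ} (f : ContinuousMultilinearMap ℂ (fun _ : Fin (n + 1) => E) ℂ)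
    (e : E) (π : E →L[ℂ] E) (c : ℂ) (y : E) (hy : y - π y = c • e) :
    f (fun _ => y) - f (fun _ => π y) = c * multilinearQuot f e π fun _ => y := by
  -- Hybrid tuples: the first `i` entries are `y`, the others `π y`. Consecutive ones differ in one
  -- slot, by `c • e`, so the difference telescopes.
  set v : ℕ → Fin (n + 1) → E := fun i j => if (j : ℕ) < i then y else π y with hv
  have h0 : v 0 = fun _ => π y := by ext j; simp [hv]
  have h1 : v (n + 1) = fun _ => y := by ext j; simp only [hv, j.isLt, if_true]
  rw [← h0, ← h1, ← Finset.sum_range_sub (fun i => f (v i)),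
    ← Fin.sum_univ_eq_sum_range (fun i => f (v (i + 1)) - f (v i)), multilinearQuot,
    sum_apply, Finset.mul_sum]
  refine Finset.sum_congr rfl fun i _ => ?_
  have e1 : v (i + 1) = Function.update (v i) i y := by
    ext j
    by_cases hj : j = i
    · subst hj; simp [hv]
    · have : (j : ℕ) ≠ i := fun h => hj (Fin.ext h)
      have h2 : (j : ℕ) < i + 1 ↔ (j : ℕ) < i := by omega
      simp [hv, hj, h2]
  have e2 : v i = Function.update (v i) i (π y) := by
    ext j
    by_cases hj : j = i
    · subst hj; simp [hv]
    · simp [hj]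
  rw [e1]
  nth_rw 2 [e2]
  rw [← ContinuousMultilinearMap.map_update_sub, hy, ContinuousMultilinearMap.map_update_smul,
    smul_eq_mul, ContinuousMultilinearMap.compContinuousLinearMap_apply,
    ContinuousMultilinearMap.curryMid_apply]
  congr 2
  refine (Fin.eq_insertNth_iff.2 ⟨by simp, ?_⟩)
  ext j
  simp only [Fin.removeNth, Function.update_of_ne (Fin.succAbove_ne i j), hv, Fin.lt_def]
  split_ifs <;> rfl

lemma norm_multilinearQuot_le {n : ℕ}
    (f : ContinuousMultilinearMap ℂ (fun _ : Fin (n + 1) => E) ℂ)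
    (e : E) (π : E →L[ℂ] E) {C : ℝ} (hC : 1 ≤ C) (hπ : ‖π‖ ≤ C) :
    ‖multilinearQuot f e π‖ ≤ (n + 1) * (‖f‖ * ‖e‖ * C ^ n) := by
  have : ∀ i ∈ (Finset.univ : Finset (Fin (n + 1))), ‖(f.curryMid i e).compContinuousLinearMap
      fun j => if i.succAbove j < i then ContinuousLinearMap.id ℂ E else π‖ ≤ ‖f‖ * ‖e‖ * C ^ n := by
    intro i _
    refine (ContinuousMultilinearMap.norm_compContinuousLinearMap_le _ _).trans ?_
    refine mul_le_mul ?_ ?_ (Finset.prod_nonneg fun _ _ => norm_nonneg _) (by positivity)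
    · refine (ContinuousLinearMap.le_opNorm _ _).trans ?_
      rw [ContinuousMultilinearMap.norm_curryMid]
    · refine (Finset.prod_le_prod (g := fun _ => C) (fun _ _ => norm_nonneg _)
        fun j _ => ?_).trans (by simp)
      split_ifs
      · exact ContinuousLinearMap.norm_id_le.trans hC
      · exact hπ
  refine (norm_sum_le_of_le _ this).trans ?_
  simp

/-- An analytic function that vanishes on the hyperplane `ℓ z = ℓ p` is divisible by `ℓ - ℓ p`. -/
theorem AnalyticAt.exists_eq_sub_mul {h : E → ℂ} {p : E} (hh : AnalyticAt ℂ h p) (ℓ : E →L[ℂ] ℂ)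
    {e : E} (he : ℓ e = 1) (hv : ∀ᶠ z in 𝓝 p, ℓ z = ℓ p → h z = 0) :
    ∃ k : E → ℂ, AnalyticAt ℂ k p ∧ ∀ᶠ z in 𝓝 p, h z = (ℓ z - ℓ p) * k z := by
  obtain ⟨P, hP⟩ := hh
  set π : E →L[ℂ] E := ContinuousLinearMap.id ℂ E - ℓ.smulRight e with hπ_def
  have hπ : ∀ y, y - π y = ℓ y • e := by intro y; simp [hπ_def]
  have hℓπ : ∀ y, ℓ (π y) = 0 := by intro y; simp [hπ_def, he]
  set K : FormalMultilinearSeries ℂ E ℂ := fun n => multilinearQuot (P (n + 1)) e π with hK_def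
  have hKr : 0 < K.radius := by
    obtain ⟨ρ, hρ0, hρ⟩ := ENNReal.lt_iff_exists_nnreal_btwn.1 hP.radius_pos
    have hρ0 : 0 < ρ := by exact_mod_cast hρ0
    obtain ⟨A, hA, hAb⟩ := P.norm_mul_pow_le_of_lt_radius hρ
    set C : ℝ≥0 := max 1 ‖π‖₊ with hC_def
    have hC1 : 1 ≤ C := le_max_left _ _
    have hC2 : ‖π‖ ≤ C := by
      have : ‖π‖₊ ≤ C := le_max_right _ _
      exact_mod_cast this
    have hC0 : 0 < C := lt_of_lt_of_le one_pos hC1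
    -- Dividing by `C` absorbs the norms of the projections, and dividing by `2` absorbs the `n + 1`
    -- summands, since `n + 1 ≤ 2 ^ n`.
    have hr0 : 0 < ρ / (2 * C) := by positivity
    refine lt_of_lt_of_le (by exact_mod_cast hr0)
      (K.le_radius_of_bound (A / ρ * ‖e‖) (r := ρ / (2 * C)) fun n => ?_)
    have hb := norm_multilinearQuot_le (P (n + 1)) e π (C := C) (by exact_mod_cast hC1) hC2
    have h2 : ((n : ℝ) + 1) ≤ 2 ^ n := by
      have : n + 1 ≤ 2 ^ n := Nat.lt_two_pow_self
      exact_mod_cast this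
    have hρ' : (0 : ℝ) < ρ := by exact_mod_cast hρ0
    have hC' : (0 : ℝ) < C := by exact_mod_cast hC0
    have h3 : ‖P (n + 1)‖ * (ρ : ℝ) ^ n ≤ A / ρ := by
      rw [le_div_iff₀ hρ', mul_assoc, ← pow_succ]
      exact hAb (n + 1)
    calc ‖K n‖ * ((ρ / (2 * C) : ℝ≥0) : ℝ) ^ n
        ≤ ((2 : ℝ) ^ n * (‖P (n + 1)‖ * ‖e‖ * (C : ℝ) ^ n)) * (ρ / (2 * C)) ^ n := by
          push_cast
          gcongr
          exact hb.trans (by gcongr)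
      _ = ‖P (n + 1)‖ * (ρ : ℝ) ^ n * ‖e‖ := by
          rw [div_pow, mul_pow]
          field_simp
      _ ≤ A / ρ * ‖e‖ := by gcongr
  have hK := (K.hasFPowerSeriesOnBall hKr).hasFPowerSeriesAt
  have hshift : Tendsto (fun z => z - p) (𝓝 p) (𝓝 0) := by
    have : Continuous fun z : E => z - p := by fun_prop
    simpa using this.tendsto p
  have hproj : Tendsto (fun z => π (z - p)) (𝓝 p) (𝓝 0) := by
    have h := (π.continuous.tendsto 0).comp hshift
    rwa [map_zero] at h
  have hproj' : Tendsto (fun z => p + π (z - p)) (𝓝 p) (𝓝 p) := by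
    simpa using hproj.const_add p
  refine ⟨fun z => K.sum (z - p), ?_, ?_⟩
  · refine AnalyticAt.fun_comp (g := K.sum) (f := fun z => z - p) ?_ (by fun_prop)
    simpa using hK.analyticAt
  · filter_upwards [hshift.eventually hP.eventually_hasSum, hproj.eventually hP.eventually_hasSum,
      hshift.eventually hK.eventually_hasSum, hproj'.eventually hv] with z h1 h2 h3 h4
    -- The projected point lies on the hyperplane, so subtracting its zero value turns the expansion
    -- of `h z` into differences divisible by `ℓ z - ℓ p`; the constant terms cancel.
    have h5 : h (p + π (z - p)) = 0 := h4 (by simp [hℓπ])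
    rw [h5] at h2
    have h6 := h1.sub h2
    rw [add_sub_cancel, sub_zero] at h6
    have h7 := (hasSum_nat_add_iff' 1).2 h6
    rw [zero_add] at h3
    have h8 := h3.mul_left (ℓ z - ℓ p)
    have h9 : ∀ n, (P (n + 1) fun _ => z - p) - (P (n + 1) fun _ => π (z - p)) =
        (ℓ z - ℓ p) * K n fun _ => z - p := fun n => by
      rw [← map_sub ℓ]
      exact multilinearQuot_spec (P (n + 1)) e π _ _ (hπ _)
    simp only [h9] at h7
    have h10 := h7.unique h8
    rw [← h10]
    have h11 : (P 0 fun _ => z - p) = P 0 fun _ => π (z - p) := congrArg _ (Subsingleton.elim _ _)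
    simp [h11]

end

/-! ### Nonzero germs, uniqueness of the continuation and squarefree germs. -/

section
variable {E : Type*} [NormedAddCommGroup E] [NormedSpace ℂ E]

/-- A germ that is not zero at `p` is not zero at nearby points. -/
lemma AnalyticAt.eventually_frequently_ne {h : E → ℂ} {p : E} (hh : AnalyticAt ℂ h p)
    (hne : ∃ᶠ z in 𝓝 p, h z ≠ 0) :
    ∀ᶠ z in 𝓝 p, AnalyticAt ℂ h z ∧ ∃ᶠ w in 𝓝 z, h w ≠ 0 := by
  obtain ⟨ε, hε, hB⟩ := Metric.eventually_nhds_iff_ball.1 hh.eventually_analyticAt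
  refine Metric.eventually_nhds_iff_ball.2 ⟨ε, hε, fun z hz => ⟨hB z hz, fun h0 => hne ?_⟩⟩
  simp only [not_not] at h0 ⊢
  have := AnalyticOnNhd.eqOn_zero_of_preconnected_of_eventuallyEq_zero (f := h) (fun w hw => hB w hw)
    (convex_ball p ε).isPreconnected hz h0
  exact Filter.eventually_of_mem (Metric.ball_mem_nhds p hε) this

/-- Points with `h ≠ 0` accumulate at every point near `p`, so continuity of `f` forces it to vanish
there too. -/
lemma AnalyticAt.eventually_eq_zero_of_ne_imp {h f : E → ℂ} {p : E} (hh : AnalyticAt ℂ h p)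
    (hne : ∃ᶠ z in 𝓝 p, h z ≠ 0) (hf : AnalyticAt ℂ f p) (h0 : ∀ᶠ z in 𝓝 p, h z ≠ 0 → f z = 0) :
    ∀ᶠ z in 𝓝 p, f z = 0 := by
  filter_upwards [hh.eventually_frequently_ne hne, hf.eventually_analyticAt,
    h0.eventually_nhds] with z h1 h2 h3
  have h4 : ∃ᶠ w in 𝓝 z, f w ∈ ({0} : Set ℂ) := (h1.2.and_eventually h3).mono fun w hw => hw.2 hw.1
  by_contra hz
  exact h4 (h2.continuousAt.eventually_ne hz)

lemma AnalyticAt.frequently_mul_ne {h f : E → ℂ} {p : E} (hh : AnalyticAt ℂ h p)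
    (hne : ∃ᶠ z in 𝓝 p, h z ≠ 0) (hf : AnalyticAt ℂ f p) (hfe : ∃ᶠ z in 𝓝 p, f z ≠ 0) :
    ∃ᶠ z in 𝓝 p, h z * f z ≠ 0 := by
  intro h0
  simp only [not_not] at h0
  refine hfe ((hh.eventually_eq_zero_of_ne_imp hne hf (h0.mono fun z hz hz' => ?_)).mono
    fun z hz => not_not.2 hz)
  exact (mul_eq_zero.1 hz).resolve_left hz'

/-- A nonzero entire function is not the zero germ at any point. -/
lemma frequently_ne_of_entire {H : E → ℂ} (hH : ∀ z, AnalyticAt ℂ H z) {x : E} (hx : H x ≠ 0)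
    (p : E) : ∃ᶠ z in 𝓝 p, H z ≠ 0 := by
  intro h0
  simp only [not_not] at h0
  have := AnalyticOnNhd.eqOn_zero_of_preconnected_of_eventuallyEq_zero (f := H)
    (fun w _ => hH w) isPreconnected_univ (Set.mem_univ p) h0
  exact hx (this (Set.mem_univ x))

/-- Uniqueness of the meromorphic continuation: a function that is locally a quotient and coincides
with `G / H` near one point coincides with it everywhere, off thin analytic sets. -/
theorem eq_quotient_of_eventually {F G H : E → ℂ}
    (hF : ∀ p, ∃ g h : E → ℂ, AnalyticAt ℂ g p ∧ AnalyticAt ℂ h p ∧ (∃ᶠ z in 𝓝 p, h z ≠ 0) ∧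
      ∀ᶠ z in 𝓝 p, h z ≠ 0 → F z = g z / h z)
    (hG : ∀ z, AnalyticAt ℂ G z) (hH : ∀ z, AnalyticAt ℂ H z) {x : E} (hx : H x ≠ 0)
    (hFx : ∀ᶠ z in 𝓝 x, F z = G z / H z) (p : E) :
    ∃ h : E → ℂ, AnalyticAt ℂ h p ∧ (∃ᶠ z in 𝓝 p, h z ≠ 0) ∧
      ∀ᶠ z in 𝓝 p, h z ≠ 0 → H z ≠ 0 ∧ F z = G z / H z := by
  set S : Set E := {p | ∃ h : E → ℂ, AnalyticAt ℂ h p ∧ (∃ᶠ z in 𝓝 p, h z ≠ 0) ∧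
      ∀ᶠ z in 𝓝 p, h z ≠ 0 → H z ≠ 0 ∧ F z = G z / H z} with hS
  have hopen : IsOpen S := by
    refine isOpen_iff_mem_nhds.2 fun z hz => ?_
    obtain ⟨h, h1, h2, h3⟩ := hz
    filter_upwards [h1.eventually_frequently_ne h2, h3.eventually_nhds] with w hw1 hw2
    exact ⟨h, hw1.1, hw1.2, hw2⟩
  have hclosed : IsClosed S := by
    refine isClosed_of_closure_subset fun z hz => ?_
    obtain ⟨g, h, h1, h2, h3, h4⟩ := hF z
    obtain ⟨ε, hε, hB⟩ := Metric.eventually_nhds_iff_ball.1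
      ((h1.eventually_analyticAt.and (h2.eventually_frequently_ne h3)).and h4)
    obtain ⟨w, hw, hwS⟩ := mem_closure_iff_nhds.1 hz _ (Metric.ball_mem_nhds z hε)
    obtain ⟨k, k1, k2, k3⟩ := hwS
    -- The two quotients agree near a point `w` of `S`; the cross-multiplied identity then spreads
    -- over the whole ball by the identity theorem.
    have hw0 : ∀ᶠ y in 𝓝 w, g y * H y - G y * h y = 0 := by
      refine AnalyticAt.eventually_eq_zero_of_ne_imp (h := fun y => h y * k y)
        ((hB w hw).1.2.1.mul k1) ((hB w hw).1.2.1.frequently_mul_ne (hB w hw).1.2.2 k1 k2)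
        (((hB w hw).1.1.mul (hH w)).sub ((hG w).mul (hB w hw).1.2.1)) ?_
      filter_upwards [k3, Metric.isOpen_ball.mem_nhds hw] with y hy1 hy2 hy3
      have hh0 : h y ≠ 0 := left_ne_zero_of_mul hy3
      obtain ⟨hH0, hFy⟩ := hy1 (right_ne_zero_of_mul hy3)
      have hFy' := (hB y hy2).2 hh0
      rw [hFy, div_eq_div_iff hH0 hh0] at hFy'
      rw [← hFy', sub_self]
    have hBall := AnalyticOnNhd.eqOn_zero_of_preconnected_of_eventuallyEq_zero
      (f := fun y => g y * H y - G y * h y)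
      (fun y hy => ((hB y hy).1.1.mul (hH y)).sub ((hG y).mul (hB y hy).1.2.1))
      (convex_ball z ε).isPreconnected hw hw0
    refine ⟨fun y => h y * H y, h2.mul (hH z), h2.frequently_mul_ne h3 (hH z)
      (frequently_ne_of_entire hH hx z), ?_⟩
    filter_upwards [Metric.ball_mem_nhds z hε] with y hy hy0
    have hh0 := left_ne_zero_of_mul hy0
    have hH0 := right_ne_zero_of_mul hy0
    refine ⟨hH0, ?_⟩
    rw [(hB y hy).2 hh0, div_eq_div_iff hh0 hH0]
    exact sub_eq_zero.1 (hBall hy)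
  have hxS : x ∈ S := by
    have hne := (hH x).continuousAt.eventually_ne hx
    refine ⟨H, hH x, hne.frequently, ?_⟩
    filter_upwards [hFx] with z hz h0
    exact ⟨h0, hz⟩
  have := IsClopen.eq_univ ⟨hclosed, hopen⟩ ⟨x, hxS⟩
  exact Set.eq_univ_iff_forall.1 this p

/-- A nonzero germ has finite vanishing order along some line. -/
lemma AnalyticAt.exists_line_order_ne_top {h : E → ℂ} {p : E} (hh : AnalyticAt ℂ h p)
    (hne : ∃ᶠ z in 𝓝 p, h z ≠ 0) : ∃ v : E, analyticOrderAt (fun t : ℂ => h (p + t • v)) 0 ≠ ⊤ := by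
  obtain ⟨ε, hε, hB⟩ := Metric.eventually_nhds_iff_ball.1 hh.eventually_analyticAt
  obtain ⟨z, hz0, hz⟩ := (hne.and_eventually (Metric.ball_mem_nhds p hε)).exists
  refine ⟨z - p, fun htop => hz0 ?_⟩
  rw [analyticOrderAt_eq_top] at htop
  set L : ℂ →ᵃ[ℝ] E := AffineMap.mk (fun t : ℂ => p + t • (z - p))
    ((LinearMap.toSpanSingleton ℂ E (z - p)).restrictScalars ℝ) (by
      intro t w; simp [add_smul]; abel) with hL
  have hLa : ∀ t, L t = p + t • (z - p) := fun _ => rfl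
  have hU : Convex ℝ (L ⁻¹' Metric.ball p ε) := (convex_ball p ε).affine_preimage L
  have := AnalyticOnNhd.eqOn_zero_of_preconnected_of_eventuallyEq_zero
    (f := fun t : ℂ => h (p + t • (z - p))) (U := L ⁻¹' Metric.ball p ε) (z₀ := 0)
    (fun t ht => AnalyticAt.fun_comp (g := h) (f := fun t : ℂ => p + t • (z - p))
      (hB _ ht) (by fun_prop)) hU.isPreconnected
    (by simp [hLa, hε]) htop
  have h1 := this (show (1 : ℂ) ∈ L ⁻¹' Metric.ball p ε by simpa [hLa] using hz)
  simpa using h1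

end

/-- Among the germs off whose zero set a condition holds, there is a squarefree one. -/
theorem exists_squarefree_germ {r : ℕ} {p : Fin r → ℂ} {Q : (Fin r → ℂ) → Prop}
    (hQ : ∃ h : (Fin r → ℂ) → ℂ, AnalyticAt ℂ h p ∧ (∃ᶠ z in 𝓝 p, h z ≠ 0) ∧
      ∀ᶠ z in 𝓝 p, h z ≠ 0 → Q z) :
    ∃ h : (Fin r → ℂ) → ℂ, (AnalyticAt ℂ h p ∧ (∃ᶠ z in 𝓝 p, h z ≠ 0) ∧
      ∀ᶠ z in 𝓝 p, h z ≠ 0 → Q z) ∧ IsSquarefreeGermAt h p := by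
  classical
  set V : ((Fin r → ℂ) → ℂ) → Prop := fun h => AnalyticAt ℂ h p ∧ (∃ᶠ z in 𝓝 p, h z ≠ 0) ∧
      ∀ᶠ z in 𝓝 p, h z ≠ 0 → Q z with hV
  -- The order is minimised over all admissible germs and all directions together.
  have hex : ∃ n : ℕ, ∃ (h : (Fin r → ℂ) → ℂ) (v : Fin r → ℂ), V h ∧
      analyticOrderAt (fun t : ℂ => h (p + t • v)) 0 = n := by
    obtain ⟨h, h1, h2, h3⟩ := hQ
    obtain ⟨v, hv⟩ := h1.exists_line_order_ne_top h2
    obtain ⟨n, hn⟩ := ENat.ne_top_iff_exists.1 hv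
    exact ⟨n, h, v, ⟨h1, h2, h3⟩, hn.symm⟩
  obtain ⟨h, v, ⟨h1, h2, h3⟩, hn⟩ := Nat.find_spec hex
  refine ⟨h, ⟨h1, h2, h3⟩, fun a b ha hb hab ha0 => ?_⟩
  have hline : ∀ f : (Fin r → ℂ) → ℂ, AnalyticAt ℂ f p →
      AnalyticAt ℂ (fun t : ℂ => f (p + t • v)) 0 := fun f hf =>
    AnalyticAt.fun_comp (g := f) (f := fun t : ℂ => p + t • v) (by simpa using hf) (by fun_prop)
  have hlt : Tendsto (fun t : ℂ => p + t • v) (𝓝 0) (𝓝 p) := by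
    have : Continuous fun t : ℂ => p + t • v := by fun_prop
    simpa using this.tendsto 0
  -- Dropping one factor `a` keeps the zero set but, as `a p = 0`, lowers the order along `v`,
  -- against minimality.
  have hVab : V fun z => a z * b z := by
    refine ⟨ha.mul hb, (h2.and_eventually hab).mono fun z hz => ?_, ?_⟩
    · intro h0
      exact hz.1 (by rw [hz.2, pow_two, mul_assoc, show a z * b z = 0 from h0, mul_zero])
    · filter_upwards [h3, hab] with z hz1 hz2 hz3
      refine hz1 ?_
      rw [hz2, pow_two, mul_assoc]
      exact mul_ne_zero (left_ne_zero_of_mul hz3) hz3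
  have hA := hline a ha
  have hB := hline b hb
  have ho : analyticOrderAt (fun t : ℂ => h (p + t • v)) 0 =
      analyticOrderAt (fun t : ℂ => a (p + t • v)) 0 +
        analyticOrderAt (fun t : ℂ => a (p + t • v) * b (p + t • v)) 0 := by
    refine Eq.trans ?_ (analyticOrderAt_mul hA (hA.mul hB))
    refine analyticOrderAt_congr ((hlt.eventually hab).mono fun t ht => ?_)
    simp only [Pi.mul_apply]
    rw [ht]; ring
  have ha1 : analyticOrderAt (fun t : ℂ => a (p + t • v)) 0 ≠ 0 :=
    analyticOrderAt_ne_zero.2 ⟨hA, by simpa using ha0⟩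
  rw [hn] at ho
  obtain ⟨m, hm⟩ := ENat.ne_top_iff_exists.1
    (show analyticOrderAt (fun t : ℂ => a (p + t • v)) 0 ≠ ⊤ from fun h => by
      rw [h, top_add] at ho; exact ENat.natCast_ne_top _ ho)
  obtain ⟨l, hl⟩ := ENat.ne_top_iff_exists.1
    (show analyticOrderAt (fun t : ℂ => a (p + t • v) * b (p + t • v)) 0 ≠ ⊤ from fun h => by
      rw [h, add_top] at ho; exact ENat.natCast_ne_top _ ho)
  rw [← hm, ← hl] at ho
  rw [← hm] at ha1
  have h5 : Nat.find hex = m + l := by exact_mod_cast ho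
  have h6 : m ≠ 0 := by exact_mod_cast ha1
  exact Nat.find_min hex (m := l) (by omega) ⟨_, v, hVab, hl.symm⟩

/-! ### The continuation as a quotient of entire functions. -/

/-- The partial sum `s₁ + ⋯ + sⱼ` as a continuous linear form. -/
noncomputable def partialSumCLM (r j : ℕ) : (Fin r → ℂ) →L[ℂ] ℂ :=
  ∑ i : Fin r with i.val < j, ContinuousLinearMap.proj i

lemma partialSumCLM_apply {r : ℕ} (j : ℕ) (s : Fin r → ℂ) : partialSumCLM r j s = partialSum s j := by
  simp [partialSumCLM, partialSum]

lemma partialSum_add_smul {r : ℕ} (z w : Fin r → ℂ) (t : ℂ) (j : ℕ) :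
    partialSum (z + t • w) j = partialSum z j + t * partialSum w j := by
  simp only [← partialSumCLM_apply, map_add, map_smul, smul_eq_mul]

lemma partialSum_analyticAt {r : ℕ} (j : ℕ) (p : Fin r → ℂ) :
    AnalyticAt ℂ (fun s : Fin r → ℂ => partialSum s j) p := by
  simp only [← partialSumCLM_apply]
  exact (partialSumCLM r j).analyticAt p

/-- Partial sums are linear coordinates: differences of the prescribed values give the entries. -/
lemma exists_partialSum_eq : {k : ℕ} → (d : ℕ → ℂ) → d 0 = 0 →
    ∃ s : Fin k → ℂ, ∀ j ≤ k, partialSum s j = d j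
  | 0, d, h0 => ⟨Fin.elim0, fun j hj => by
      obtain rfl : j = 0 := by omega
      rw [partialSum_zero, h0]⟩
  | k + 1, d, h0 => by
    obtain ⟨s, hs⟩ := exists_partialSum_eq (k := k) (fun j => d (j + 1) - d 1) (by simp)
    refine ⟨Fin.cons (d 1) s, fun j hj => ?_⟩
    cases j with
    | zero => rw [partialSum_zero, h0]
    | succ j =>
      rw [partialSum_succ, Fin.cons_zero, Fin.tail_cons, hs j (by omega)]
      ring

section
variable {q : ℝ}

/-- The entire numerator of the continuation. -/
noncomputable def bzNum (hq0 : 0 < q) (hq1 : q < 1) {r : ℕ} (s : Fin r → ℂ) : ℂ :=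
  ((1 - q : ℝ) : ℂ) ^ (∑ i, s i) * bzEntire q hq0 hq1 r s 0 0

/-- The entire denominator of the continuation. -/
noncomputable def bzDen (q : ℝ) {r : ℕ} (s : Fin r → ℂ) : ℂ :=
  ∏ j : Fin r, qE q (partialSum s (j + 1) - (j + 1 : ℕ))

lemma one_sub_cpow_ne_zero (hq1 : q < 1) (z : ℂ) : ((1 - q : ℝ) : ℂ) ^ z ≠ 0 := by
  rw [Complex.cpow_def_of_ne_zero (by exact_mod_cast (sub_pos.2 hq1).ne')]
  exact Complex.exp_ne_zero _

lemma bzNum_analyticAt (hq0 : 0 < q) (hq1 : q < 1) {r : ℕ} (p : Fin r → ℂ) : AnalyticAt ℂ (bzNum hq0 hq1) p := by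
  have hproj : ∀ i, AnalyticAt ℂ (fun s : Fin r → ℂ => s i) p := fun i =>
    (ContinuousLinearMap.proj (R := ℂ) (φ := fun _ : Fin r => ℂ) i).analyticAt p
  have h1 : AnalyticAt ℂ (fun s : Fin r → ℂ => ∑ i, s i) p :=
    Finset.analyticAt_fun_sum _ fun i _ => hproj i
  have h2 : AnalyticAt ℂ (fun s : Fin r → ℂ => ((1 - q : ℝ) : ℂ) ^ (∑ i, s i)) p :=
    analyticAt_const.cpow h1 (Complex.ofReal_mem_slitPlane.2 (sub_pos.2 hq1))
  have h3 := bzEntire_analyticAt hq0 hq1 r (σ := fun s : Fin r → ℂ => s) (γ := fun _ => 0)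
    (z := p) hproj analyticAt_const
  exact h2.mul (((BoundedContinuousFunction.evalCLM (β := ℂ) ℂ (0 : ℕ)).analyticAt _).comp h3)

lemma qE_partialSum_analyticAt (hq0 : 0 < q) (hq1 : q < 1) {r : ℕ} (j : ℕ) (c : ℂ) (p : Fin r → ℂ) :
    AnalyticAt ℂ (fun s : Fin r → ℂ => qE q (partialSum s j - c)) p :=
  AnalyticAt.fun_comp (g := qE q) (f := fun s : Fin r → ℂ => partialSum s j - c)
    ((qE_differentiable hq0 hq1).analyticAt _) ((partialSum_analyticAt j p).sub analyticAt_const)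

lemma bzDen_analyticAt (hq0 : 0 < q) (hq1 : q < 1) {r : ℕ} (p : Fin r → ℂ) : AnalyticAt ℂ (bzDen q) p :=
  Finset.analyticAt_fun_prod _ fun _ _ => qE_partialSum_analyticAt hq0 hq1 _ _ p

lemma zConv_of_mem_bzDomain {r : ℕ} {s : Fin r → ℂ} (hs : s ∈ bzDomain r) : ZConv s 0 :=
  zConv_of_forall fun d h1 h2 => by simpa using hs d h1 h2

lemma bzDen_eq_zDenom {r : ℕ} (s : Fin r → ℂ) : bzDen q s = zDenom q s 0 := by
  simp only [zDenom_eq_prod, zero_add, bzDen]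

lemma bzDen_ne_zero (hq0 : 0 < q) (hq1 : q < 1) {r : ℕ} {s : Fin r → ℂ} (hs : s ∈ bzDomain r) : bzDen q s ≠ 0 := by
  refine Finset.prod_ne_zero_iff.2 fun j _ h0 => ?_
  obtain ⟨n, hn⟩ := (qE_eq_zero_iff hq0 hq1).1 h0
  have h1 := hs (j + 1) (by omega) (by omega)
  have h2 : 0 < (partialSum s (j + 1) - ((j + 1 : ℕ) : ℂ) + n).re := by
    rw [Complex.add_re, Complex.sub_re, Complex.natCast_re, Complex.natCast_re]
    have : (0 : ℝ) ≤ n := n.cast_nonneg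
    linarith
  have h3 := norm_qpow_lt_one hq0 hq1 h2
  rw [hn, norm_one] at h3
  exact lt_irrefl _ h3

lemma summable_bzTerm (hq0 : 0 < q) (hq1 : q < 1) {r : ℕ} {s : Fin r → ℂ} (hs : s ∈ bzDomain r) : Summable (bzTerm q s) := by
  simp only [funext (bzTerm_eq hq0 hq1 s)]
  exact (summable_zTerm hq0 hq1 (zConv_of_mem_bzDomain hs)).mul_left _

lemma bzZeta_eq_div (hq0 : 0 < q) (hq1 : q < 1) {r : ℕ} {s : Fin r → ℂ} (hs : s ∈ bzDomain r) :
    bzZeta q s = bzNum hq0 hq1 s / bzDen q s := by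
  rw [eq_div_iff (bzDen_ne_zero hq0 hq1 hs), bzZeta, bzNum, bzDen_eq_zDenom,
    bzEntire_eq_tsum_mul hq0 hq1 (zConv_of_mem_bzDomain hs), Nat.cast_zero, add_zero,
    ← mul_assoc, ← tsum_mul_left]
  simp only [funext (bzTerm_eq hq0 hq1 s)]

lemma isOpen_bzDomain (r : ℕ) : IsOpen (bzDomain r) := by
  have : bzDomain r = ⋂ d ∈ Finset.Icc 1 r, {s : Fin r → ℂ | (d : ℝ) < (partialSum s d).re} := by
    ext s; simp [bzDomain]
  rw [this]
  refine isOpen_biInter_finset fun d _ => isOpen_lt continuous_const ?_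
  simp only [← partialSumCLM_apply]
  fun_prop

lemma bzDomain_nonempty (r : ℕ) : (bzDomain r).Nonempty := by
  obtain ⟨s, hs⟩ := exists_partialSum_eq (k := r) (fun j => 2 * (j : ℂ)) (by simp)
  refine ⟨s, fun d h1 h2 => ?_⟩
  have : (1 : ℝ) ≤ d := by exact_mod_cast h1
  rw [hs d h2]
  simp
  linarith

lemma bzDen_frequently_ne (hq0 : 0 < q) (hq1 : q < 1) {r : ℕ} (p : Fin r → ℂ) : ∃ᶠ z in 𝓝 p, bzDen q z ≠ 0 := by
  obtain ⟨x, hx⟩ := bzDomain_nonempty r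
  exact frequently_ne_of_entire (bzDen_analyticAt hq0 hq1) (bzDen_ne_zero hq0 hq1 hx) p

lemma isBZContinuation_div (hq0 : 0 < q) (hq1 : q < 1) (r : ℕ) :
    IsBZContinuation q fun s : Fin r → ℂ => bzNum hq0 hq1 s / bzDen q s :=
  ⟨fun p => ⟨bzNum hq0 hq1, bzDen q, bzNum_analyticAt hq0 hq1 p, bzDen_analyticAt hq0 hq1 p,
    bzDen_frequently_ne hq0 hq1 p, .of_forall fun _ _ => rfl⟩,
    fun _ hs => (bzZeta_eq_div hq0 hq1 hs).symm⟩

lemma IsBZContinuation.eq_div (hq0 : 0 < q) (hq1 : q < 1) {r : ℕ} {F : (Fin r → ℂ) → ℂ} (hF : IsBZContinuation q F)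
    (p : Fin r → ℂ) : ∃ h : (Fin r → ℂ) → ℂ, AnalyticAt ℂ h p ∧ (∃ᶠ z in 𝓝 p, h z ≠ 0) ∧
      ∀ᶠ z in 𝓝 p, h z ≠ 0 → bzDen q z ≠ 0 ∧ F z = bzNum hq0 hq1 z / bzDen q z := by
  obtain ⟨x, hx⟩ := bzDomain_nonempty r
  refine eq_quotient_of_eventually hF.1 (bzNum_analyticAt hq0 hq1) (bzDen_analyticAt hq0 hq1)
    (bzDen_ne_zero hq0 hq1 hx) ?_ p
  filter_upwards [(isOpen_bzDomain r).mem_nhds hx] with s hs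
  rw [hF.2 s hs, bzZeta_eq_div hq0 hq1 hs]

/-! ### Values of the numerator -/

lemma bzEntire_eq_single (hq0 : 0 < q) (hq1 : q < 1) {k : ℕ} {s : Fin (k + 1) → ℂ} {c : ℂ} {m n : ℕ}
    (h : (q : ℂ) ^ (c + s 0 - 1 + (m + n : ℕ)) = 1) :
    bzEntire q hq0 hq1 (k + 1) s c m = binomCoeff (s 0) n * qPhi q (m + n) (c + s 0 - 1) *
      bzEntire q hq0 hq1 k (Fin.tail s) (c + s 0 - 1) (m + n) := by
  rw [bzEntire_succ_apply]
  refine tsum_eq_single n fun l hl => ?_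
  rw [qPhi_eq_zero hq0 hq1 h (by omega), mul_zero, zero_mul]

/-- All layers resonate at the same `N`, so each series collapses to its term `n = 0`, whose
binomial coefficient is `1`, and the index stays `N`. -/
lemma bzEntire_ne_zero (hq0 : 0 < q) (hq1 : q < 1) : {k : ℕ} → {s : Fin k → ℂ} → {c : ℂ} → {N : ℕ} →
    (∀ j : ℕ, 1 ≤ j → j ≤ k → (q : ℂ) ^ (c + partialSum s j - j + N) = 1) →
    bzEntire q hq0 hq1 k s c N ≠ 0
  | 0, _, _, _, _ => by
    change (1 : ℂ) ≠ 0
    exact one_ne_zero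
  | k + 1, s, c, N, h => by
    have h0 : (q : ℂ) ^ (c + s 0 - 1 + (N + 0 : ℕ)) = 1 := by
      simpa [partialSum_one] using h 1 le_rfl (by omega)
    rw [bzEntire_eq_single hq0 hq1 h0, binomCoeff_zero, one_mul]
    refine mul_ne_zero (qPhi_ne_zero hq0 hq1 h0) (bzEntire_ne_zero hq0 hq1 fun j h1 h2 => ?_)
    refine Eq.trans ?_ (h (j + 1) (by omega) (by omega))
    rw [partialSum_succ]
    congr 1
    push_cast
    ring

/-- The outermost layer has to move the index from `0` to `N`, which costs `binomCoeff (s 0) N`; the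
inner layers then stay at `N`. -/
lemma bzNum_ne_zero (hq0 : 0 < q) (hq1 : q < 1) {k : ℕ} {s : Fin (k + 1) → ℂ} {N : ℕ}
    (h : ∀ j : ℕ, 1 ≤ j → j ≤ k + 1 → (q : ℂ) ^ (partialSum s j - j + N) = 1)
    (hN : binomCoeff (s 0) N ≠ 0) : bzNum hq0 hq1 s ≠ 0 := by
  have h0 : (q : ℂ) ^ (0 + s 0 - 1 + (0 + N : ℕ)) = 1 := by
    simpa [partialSum_one] using h 1 le_rfl (by omega)
  refine mul_ne_zero (one_sub_cpow_ne_zero hq1 _) ?_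
  rw [bzEntire_eq_single hq0 hq1 h0]
  rw [zero_add] at h0
  refine mul_ne_zero (mul_ne_zero hN ?_) (bzEntire_ne_zero hq0 hq1 fun j h1 h2 => ?_)
  · rw [zero_add, zero_add]
    exact qPhi_ne_zero hq0 hq1 (by simpa using h0)
  · refine Eq.trans ?_ (h (j + 1) (by omega) (by omega))
    rw [partialSum_succ]
    congr 1
    push_cast
    ring

/-- Only the `N`-th term survives, and its binomial coefficient contains the factor `s 0 + (N - 1) =
0`. This removes the real candidates `s₁ ≤ 0`. -/
lemma bzNum_eq_zero (hq0 : 0 < q) (hq1 : q < 1) {k : ℕ} {s : Fin (k + 1) → ℂ} {N : ℕ} (hN : N ≠ 0) (hs : s 0 = 1 - N) :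
    bzNum hq0 hq1 s = 0 := by
  have h0 : (q : ℂ) ^ (0 + s 0 - 1 + (0 + N : ℕ)) = 1 := by
    rw [hs]
    push_cast
    rw [show (0 : ℂ) + (1 - N) - 1 + (0 + N) = 0 by ring, Complex.cpow_zero]
  have h1 : binomCoeff (s 0) N = 0 := by
    refine binomCoeff_eq_zero_iff.2 ⟨N - 1, by omega, ?_⟩
    rw [hs, Nat.cast_sub (by omega)]
    push_cast
    ring
  rw [bzNum, bzEntire_eq_single hq0 hq1 h0, h1, zero_mul, zero_mul, mul_zero]

end

/-! ### Divisibility by the denominator, and the poles. -/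

section
variable {q : ℝ}

lemma qE_eventually_ne (hq0 : 0 < q) (hq1 : q < 1) (c : ℂ) :
    ∀ᶠ t in 𝓝[≠] (0 : ℂ), qE q (c + t) ≠ 0 := by
  have ht : Tendsto (fun t : ℂ => c + t) (𝓝 0) (𝓝 c) := by
    have : Continuous fun t : ℂ => c + t := by fun_prop
    simpa using this.tendsto 0
  by_cases hc : qE q c = 0
  · obtain ⟨k, hk, hkc, hE⟩ := qE_eq_sub_mul hq0 hq1 hc
    filter_upwards [nhdsWithin_le_nhds (ht.eventually (hk.continuousAt.eventually_ne hkc)),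
      self_mem_nhdsWithin] with t h1 h2
    rw [hE, add_sub_cancel_left]
    exact mul_ne_zero h2 h1
  · exact nhdsWithin_le_nhds
      (ht.eventually ((qE_differentiable hq0 hq1).continuous.continuousAt.eventually_ne hc))

/-- A germ that vanishes on the zero set of `bzDen q` is divisible by `bzDen q`. -/
theorem exists_eq_bzDen_mul (hq0 : 0 < q) (hq1 : q < 1) {r : ℕ} {p : Fin r → ℂ}
    {h : (Fin r → ℂ) → ℂ} (hh : AnalyticAt ℂ h p) (hv : ∀ᶠ z in 𝓝 p, bzDen q z = 0 → h z = 0) :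
    ∃ k : (Fin r → ℂ) → ℂ, AnalyticAt ℂ k p ∧ ∀ᶠ z in 𝓝 p, h z = bzDen q z * k z := by
  classical
  set e : Fin r → (Fin r → ℂ) → ℂ := fun j z => qE q (partialSum z (j + 1) - (j + 1 : ℕ)) with he
  have hea : ∀ j z, AnalyticAt ℂ (e j) z := fun j z => qE_partialSum_analyticAt hq0 hq1 _ _ z
  suffices H : ∀ J : Finset (Fin r), ∃ k : (Fin r → ℂ) → ℂ, AnalyticAt ℂ k p ∧
      ∀ᶠ z in 𝓝 p, h z = (∏ j ∈ J, e j z) * k z from H Finset.univ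
  intro J
  induction J using Finset.induction_on with
  | empty => exact ⟨h, hh, .of_forall fun z => by simp⟩
  | insert j J hj ih =>
    obtain ⟨k, hk, hkJ⟩ := ih
    by_cases hp : e j p = 0
    · obtain ⟨κ, hκ, hκ0, hE⟩ := qE_eq_sub_mul hq0 hq1 hp
      set c := partialSum p (j + 1) - ((j + 1 : ℕ) : ℂ) with hc
      have hκa : AnalyticAt ℂ (fun z : Fin r → ℂ => κ (partialSum z (j + 1) - (j + 1 : ℕ))) p :=
        AnalyticAt.fun_comp (g := κ) (f := fun z : Fin r → ℂ => partialSum z (j + 1) - (j + 1 : ℕ))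
          hκ ((partialSum_analyticAt _ p).sub analyticAt_const)
      -- Moving along `w` fixes the partial sum of index `j + 1` and changes all the others at unit
      -- speed, so it stays in one hyperplane while leaving the zeros of the other factors.
      obtain ⟨w, hw⟩ := exists_partialSum_eq (k := r)
        (fun i => if i = j + 1 ∨ i = 0 then 0 else 1) (by simp)
      obtain ⟨v, hv1⟩ := exists_partialSum_eq (k := r) (fun i => if i = 0 then 0 else 1) (by simp)
      -- On the hyperplane `h` vanishes, and off the other factors so does `k`; the limit `t → 0`
      -- along `w` covers the intersections.
      have hvan : ∀ᶠ z in 𝓝 p, partialSumCLM r (j + 1) z = partialSumCLM r (j + 1) p → k z = 0 := by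
        filter_upwards [hk.eventually_analyticAt, hkJ.eventually_nhds, hv.eventually_nhds]
          with z h1 h2 h3 hz
        have hline : Tendsto (fun t : ℂ => z + t • w) (𝓝 0) (𝓝 z) := by
          have : Continuous fun t : ℂ => z + t • w := by fun_prop
          simpa using this.tendsto 0
        have hline' := hline.mono_left (nhdsWithin_le_nhds (s := {0}ᶜ))
        have hJ : ∀ᶠ t in 𝓝[≠] (0 : ℂ), ∀ i ∈ J, e i (z + t • w) ≠ 0 := by
          rw [Filter.eventually_all_finset]
          intro i hi
          have hij : (i : ℕ) ≠ j := fun h => hj (Fin.ext h ▸ hi)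
          filter_upwards [qE_eventually_ne hq0 hq1 (partialSum z (i + 1) - ((i + 1 : ℕ) : ℂ))]
            with t ht
          have : e i (z + t • w) = qE q (partialSum z (i + 1) - ((i + 1 : ℕ) : ℂ) + t) := by
            simp only [he]
            rw [partialSum_add_smul, hw (i + 1) (by omega)]
            congr 1
            simp [hij]
            ring
          rwa [this]
        have hk0 : ∀ᶠ t in 𝓝[≠] (0 : ℂ), k (z + t • w) = 0 := by
          filter_upwards [hJ, hline'.eventually h2, hline'.eventually h3] with t t1 t2 t3
          have hjz : e j (z + t • w) = 0 := by
            simp only [he]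
            rw [partialSum_add_smul, hw (j + 1) (by omega), ← partialSumCLM_apply, hz,
              partialSumCLM_apply]
            simpa [he] using hp
          rw [t3 (Finset.prod_eq_zero (Finset.mem_univ j) hjz)] at t2
          exact (mul_eq_zero.1 t2.symm).resolve_left (Finset.prod_ne_zero_iff.2 t1)
        have h5 : Tendsto (fun t : ℂ => k (z + t • w)) (𝓝[≠] 0) (𝓝 (k z)) :=
          h1.continuousAt.tendsto.comp hline'
        exact tendsto_nhds_unique h5 (tendsto_const_nhds.congr' (hk0.mono fun t ht => ht.symm))
      obtain ⟨k₁, hk₁, hkk⟩ := hk.exists_eq_sub_mul (partialSumCLM r (j + 1)) (e := v)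
        (by rw [partialSumCLM_apply, hv1 _ (by omega)]; simp) hvan
      refine ⟨fun z => k₁ z / κ (partialSum z (j + 1) - (j + 1 : ℕ)), hk₁.div hκa hκ0, ?_⟩
      filter_upwards [hkJ, hkk, hκa.continuousAt.eventually_ne hκ0] with z h1 h2 h3
      rw [h1, h2, Finset.prod_insert hj, partialSumCLM_apply, partialSumCLM_apply]
      simp only [he]
      rw [hE, hc]
      field_simp
      ring
    · refine ⟨fun z => k z / e j z, hk.div (hea j p) hp, ?_⟩
      filter_upwards [hkJ, (hea j p).continuousAt.eventually_ne hp] with z h1 h2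
      rw [h1, Finset.prod_insert hj]
      field_simp

/-- Writing `N = j - a` puts the three families into the form of the zeros of `qE q`; the last
condition excludes just the cancelling hyperplanes `s₁ = 1 - N`, `N ≥ 1`. -/
lemma mem_bzPoleSet_iff {r : ℕ} (hr : 1 ≤ r) {s : Fin r → ℂ} :
    s ∈ bzPoleSet q r ↔ ∃ (j N : ℕ) (b : ℤ), 1 ≤ j ∧ j ≤ r ∧
      partialSum s j = j - N + qPeriod q * b ∧ (j = 1 → N = 0 ∨ b ≠ 0) := by
  constructor
  · rintro (⟨b, hb⟩ | ⟨a, b, ha, hb, h⟩ | ⟨j, h2, hj, a, b, ha, h⟩)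
    · exact ⟨1, 0, b, le_rfl, hr, by simpa using hb, fun _ => Or.inl rfl⟩
    · obtain ⟨N, hN⟩ := Int.eq_ofNat_of_zero_le (show 0 ≤ 1 - a by omega)
      refine ⟨1, N, b, le_rfl, hr, ?_, fun _ => Or.inr hb⟩
      rw [h, show a = 1 - N by omega]
      push_cast
      ring
    · obtain ⟨N, hN⟩ := Int.eq_ofNat_of_zero_le (show 0 ≤ (j : ℤ) - a by omega)
      refine ⟨j, N, b, by omega, hj, ?_, fun _ => by omega⟩
      rw [h, show a = j - N by omega]
      push_cast
      ring
  · rintro ⟨j, N, b, h1, hj, h, hor⟩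
    by_cases hj1 : j = 1
    · subst hj1
      by_cases hN : N = 0
      · subst hN
        exact Or.inl ⟨b, by simpa using h⟩
      · refine Or.inr (Or.inl ⟨1 - N, b, by omega, (hor rfl).resolve_left hN, ?_⟩)
        rw [h]
        push_cast
        ring
    · refine Or.inr (Or.inr ⟨j, by omega, hj, j - N, b, by omega, ?_⟩)
      rw [h]
      push_cast
      ring

lemma qpow_eq_one_of_eq (hq0 : 0 < q) (hq1 : q < 1) {u : ℂ} {j N : ℕ} {b : ℤ}
    (h : u = j - N + qPeriod q * b) : (q : ℂ) ^ (u - j + N) = 1 :=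
  (qpow_eq_one_iff hq0 hq1).2 ⟨b, by rw [h]; ring⟩

/-- The points of `bzPoleSet q r` are poles. -/
lemma not_isRegularAt (hq0 : 0 < q) (hq1 : q < 1) {r : ℕ} (hr : 1 ≤ r) {F : (Fin r → ℂ) → ℂ}
    (hF : IsBZContinuation q F) {p : Fin r → ℂ} (hp : p ∈ bzPoleSet q r) : ¬ IsRegularAt F p := by
  rintro ⟨f, h, hf, hh, hne, hFf⟩
  obtain ⟨h', hh', hne', hF'⟩ := hF.eq_div hq0 hq1 p
  obtain ⟨j, N, b, hj1, hjr, hpj, hor⟩ := (mem_bzPoleSet_iff hr).1 hp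
  have hmul : ∀ᶠ z in 𝓝 p, f z * bzDen q z - bzNum hq0 hq1 z = 0 := by
    refine AnalyticAt.eventually_eq_zero_of_ne_imp (h := fun z => h z * h' z) (hh.mul hh')
      (hh.frequently_mul_ne hne hh' hne')
      ((hf.mul (bzDen_analyticAt hq0 hq1 p)).sub (bzNum_analyticAt hq0 hq1 p)) ?_
    filter_upwards [hFf, hF'] with z h1 h2 h3
    obtain ⟨h4, h5⟩ := h2 (right_ne_zero_of_mul h3)
    rw [← h1 (left_ne_zero_of_mul h3), h5, div_mul_cancel₀ _ h4, sub_self]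
  obtain ⟨v, hv⟩ := exists_partialSum_eq (k := r) (fun i => if i = 0 then 0 else 1) (by simp)
  have hvj : partialSum v j = 1 := by
    rw [hv j hjr]; simp [show j ≠ 0 by omega]
  -- A retraction onto the hyperplane through `p` on which the `j`-th factor of `bzDen` vanishes.
  -- Regularity at `p` would make `bzNum ∘ ψ` vanish near `p`, hence everywhere.
  set ψ : (Fin r → ℂ) → Fin r → ℂ := fun z => z + (partialSum p j - partialSum z j) • v with hψ
  have hψa : ∀ z, AnalyticAt ℂ ψ z := fun z =>
    analyticAt_id.add ((analyticAt_const.sub (partialSum_analyticAt j z)).smul analyticAt_const)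
  have hψp : ψ p = p := by simp [hψ]
  have hψj : ∀ z, partialSum (ψ z) j = partialSum p j := fun z => by
    simp only [hψ]
    rw [partialSum_add_smul, hvj]
    ring
  have hden : ∀ z, bzDen q (ψ z) = 0 := fun z => by
    refine Finset.prod_eq_zero (Finset.mem_univ ⟨j - 1, by omega⟩) ?_
    refine (qE_eq_zero_iff hq0 hq1).2 ⟨N, ?_⟩
    simp only [show j - 1 + 1 = j by omega]
    exact qpow_eq_one_of_eq hq0 hq1 ((hψj z).trans hpj)
  have hψt : Tendsto ψ (𝓝 p) (𝓝 p) := by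
    have := (hψa p).continuousAt.tendsto
    rwa [hψp] at this
  have hzero : ∀ᶠ z in 𝓝 p, bzNum hq0 hq1 (ψ z) = 0 := by
    filter_upwards [hψt.eventually hmul] with z hz
    rw [hden, mul_zero, zero_sub, neg_eq_zero] at hz
    exact hz
  -- A point of the same hyperplane where every partial sum resonates at `N`. The period multiple
  -- `1` for `i ≠ j` makes `s₁` nonreal when `j ≠ 1`, so that `binomCoeff (s 0) N ≠ 0`.
  obtain ⟨s, hs⟩ := exists_partialSum_eq (k := r)
    (fun i => if i = 0 then 0 else (i : ℂ) - N + qPeriod q * ((if i = j then b else 1 : ℤ) : ℂ))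
    (by simp)
  have hs' : ∀ i : ℕ, 1 ≤ i → i ≤ r →
      partialSum s i = i - N + qPeriod q * ((if i = j then b else 1 : ℤ) : ℂ) := fun i h1 h2 => by
    rw [hs i h2, if_neg (by omega)]
  have hψs : ψ s = s := by
    have : partialSum s j = partialSum p j := by rw [hs' j hj1 hjr, hpj, if_pos rfl]
    simp [hψ, this]
  have h0 : bzNum hq0 hq1 (ψ s) = 0 := by
    have := AnalyticOnNhd.eqOn_zero_of_preconnected_of_eventuallyEq_zero
      (f := fun z => bzNum hq0 hq1 (ψ z)) (U := Set.univ)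
      (fun z _ => AnalyticAt.fun_comp (g := bzNum hq0 hq1) (bzNum_analyticAt hq0 hq1 (ψ z)) (hψa z))
      isPreconnected_univ (Set.mem_univ p) hzero
    exact this (Set.mem_univ s)
  rw [hψs] at h0
  obtain ⟨k, rfl⟩ : ∃ k, r = k + 1 := ⟨r - 1, by omega⟩
  refine bzNum_ne_zero hq0 hq1 (N := N)
    (fun i h1 h2 => qpow_eq_one_of_eq hq0 hq1 (hs' i h1 h2)) (fun hb => ?_) h0
  obtain ⟨l, hl, hsl⟩ := binomCoeff_eq_zero_iff.1 hb
  have hs1 := hs' 1 le_rfl (by omega)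
  rw [partialSum_one, hsl] at hs1
  have him := congrArg Complex.im hs1
  have hP := qPeriod_im_ne_zero hq0 hq1
  split_ifs at him with h1
  · rcases hor h1.symm with h2 | h2
    · omega
    · simp [Complex.mul_im, hP, h2] at him
  · exact hP (by simpa using him.symm)

/-- The points outside `bzPoleSet q r` are not poles. -/
lemma isRegularAt (hq0 : 0 < q) (hq1 : q < 1) {r : ℕ} (hr : 1 ≤ r) {F : (Fin r → ℂ) → ℂ}
    (hF : IsBZContinuation q F) {p : Fin r → ℂ} (hp : p ∉ bzPoleSet q r) : IsRegularAt F p := by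
  obtain ⟨h, hh, hne, hFh⟩ := hF.eq_div hq0 hq1 p
  obtain ⟨k, rfl⟩ : ∃ k, r = k + 1 := ⟨r - 1, by omega⟩
  -- Off the pole set only the first factor of `bzDen` can vanish, and only at a cancelling value of
  -- `s₁`.
  have hfac : ∀ i : Fin (k + 1), qE q (partialSum p (i + 1) - ((i + 1 : ℕ) : ℂ)) = 0 →
      i = 0 ∧ ∃ N : ℕ, N ≠ 0 ∧ p 0 = 1 - N := by
    intro i hi
    obtain ⟨N, hN⟩ := (qE_eq_zero_iff hq0 hq1).1 hi
    obtain ⟨b, hb⟩ := (qpow_eq_one_iff hq0 hq1).1 hN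
    have hb' : partialSum p (i + 1) = ((i + 1 : ℕ) : ℂ) - N + qPeriod q * b := by
      rw [← hb]; ring
    have hnot : ¬ ((i : ℕ) + 1 = 1 → N = 0 ∨ b ≠ 0) := fun hor =>
      hp ((mem_bzPoleSet_iff hr).2 ⟨i + 1, N, b, by omega, by omega, hb', hor⟩)
    push Not at hnot
    obtain ⟨hi0, hN0, hb0⟩ := hnot
    have hi0' : (i : ℕ) = 0 := by omega
    refine ⟨Fin.ext hi0', N, hN0, ?_⟩
    rw [hi0', hb0, zero_add, partialSum_one] at hb'
    simpa using hb'
  by_cases h0 : qE q (partialSum p 1 - ((1 : ℕ) : ℂ)) = 0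
  · obtain ⟨-, N, hN, hpN⟩ := hfac 0 (by simpa using h0)
    obtain ⟨κ, hκ, hκ0, hE⟩ := qE_eq_sub_mul hq0 hq1 h0
    have hκa : AnalyticAt ℂ (fun z : Fin (k + 1) → ℂ => κ (partialSum z 1 - (1 : ℕ))) p :=
      AnalyticAt.fun_comp (g := κ) (f := fun z : Fin (k + 1) → ℂ => partialSum z 1 - (1 : ℕ))
        hκ ((partialSum_analyticAt _ p).sub analyticAt_const)
    obtain ⟨v, hv⟩ := exists_partialSum_eq (k := k + 1) (fun i => if i = 0 then 0 else 1) (by simp)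
    obtain ⟨g, hg, hgn⟩ := (bzNum_analyticAt hq0 hq1 p).exists_eq_sub_mul (partialSumCLM (k + 1) 1)
      (e := v) (by rw [partialSumCLM_apply, hv 1 (by omega)]; simp) (.of_forall fun z hz => by
        rw [partialSumCLM_apply, partialSumCLM_apply, partialSum_one, partialSum_one, hpN] at hz
        exact bzNum_eq_zero hq0 hq1 hN hz)
    set D : (Fin (k + 1) → ℂ) → ℂ := fun z =>
      ∏ i : Fin k, qE q (partialSum z (i.succ + 1) - ((i.succ + 1 : ℕ) : ℂ)) with hD
    have hDa : AnalyticAt ℂ D p :=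
      Finset.analyticAt_fun_prod _ fun i _ => qE_partialSum_analyticAt hq0 hq1 _ _ p
    have hD0 : D p ≠ 0 := Finset.prod_ne_zero_iff.2 fun i _ hi =>
      Fin.succ_ne_zero i (hfac i.succ hi).1
    refine ⟨fun z => g z / (κ (partialSum z 1 - (1 : ℕ)) * D z), h,
      hg.div (hκa.mul hDa) (mul_ne_zero hκ0 hD0), hh, hne, ?_⟩
    filter_upwards [hFh, hgn] with z h1 h2 h3
    obtain ⟨h4, h5⟩ := h1 h3
    have h6 : bzDen q z =
        (partialSum z 1 - partialSum p 1) * κ (partialSum z 1 - (1 : ℕ)) * D z := by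
      rw [bzDen, Fin.prod_univ_succ]
      congr 1
      simp only [Fin.val_zero, zero_add]
      rw [hE]
      ring
    rw [h6] at h4
    rw [h5, h2, h6, partialSumCLM_apply, partialSumCLM_apply, mul_assoc]
    exact mul_div_mul_left _ _ (left_ne_zero_of_mul (left_ne_zero_of_mul h4))
  · have hden : bzDen q p ≠ 0 := by
      refine Finset.prod_ne_zero_iff.2 fun i _ hi => h0 ?_
      obtain ⟨rfl, -⟩ := hfac i hi
      simpa using hi
    exact ⟨fun z => bzNum hq0 hq1 z / bzDen q z, h,
      (bzNum_analyticAt hq0 hq1 p).div (bzDen_analyticAt hq0 hq1 p) hden, hh, hne,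
      hFh.mono fun z hz h => (hz h).2⟩

/-- A squarefree `h` off whose zeros the quotient formula holds vanishes wherever `bzDen` does, so
`h = bzDen * k` and `bzNum * k / h` represents `F`. -/
lemma exists_isQuotientAt_squarefree (hq0 : 0 < q) (hq1 : q < 1) {r : ℕ} {F : (Fin r → ℂ) → ℂ}
    (hF : IsBZContinuation q F) (p : Fin r → ℂ) :
    ∃ g h : (Fin r → ℂ) → ℂ, IsQuotientAt F g h p ∧ IsSquarefreeGermAt h p := by
  obtain ⟨h, ⟨hh, hne, hFh⟩, hsq⟩ := exists_squarefree_germ (hF.eq_div hq0 hq1 p)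
  obtain ⟨k, hk, hhk⟩ := exists_eq_bzDen_mul hq0 hq1 hh (hFh.mono fun z hz h0 => by
    by_contra hc
    exact (hz hc).1 h0)
  refine ⟨fun z => bzNum hq0 hq1 z * k z, h, ⟨(bzNum_analyticAt hq0 hq1 p).mul hk, hh, hne, ?_⟩,
    hsq⟩
  filter_upwards [hFh, hhk] with z h1 h2 h3
  rw [(h1 h3).2, h2]
  rw [h2] at h3
  exact (mul_div_mul_right _ _ (right_ne_zero_of_mul h3)).symm

end

/-- For `0 < q < 1` and depth `r ≥ 1`: the defining series converges on its domain, it has a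
meromorphic continuation to `ℂ^r`, and for the (essentially unique) continuation the set of poles
is exactly `bzPoleSet q r` and all poles are simple. -/
theorem mainTheorem9 (q : ℝ) (hq0 : 0 < q) (hq1 : q < 1) (r : ℕ) (hr : 1 ≤ r) :
    (∀ s ∈ bzDomain r, Summable (bzTerm q s)) ∧
    (∃ F : (Fin r → ℂ) → ℂ, IsBZContinuation q F) ∧
    ∀ F : (Fin r → ℂ) → ℂ, IsBZContinuation q F →
      poles F = bzPoleSet q r ∧ ∀ p ∈ poles F, IsSimplePole F p := by
  refine ⟨fun s hs => summable_bzTerm hq0 hq1 hs, ⟨_, isBZContinuation_div hq0 hq1 r⟩,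
    fun F hF => ⟨?_, fun p hp => ⟨hp, exists_isQuotientAt_squarefree hq0 hq1 hF p⟩⟩⟩
  ext p
  exact ⟨fun hp => by_contra fun hn => hp (isRegularAt hq0 hq1 hr hF hn),
    fun hp => not_isRegularAt hq0 hq1 hr hF hp⟩
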